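/- Let $n,m\ge 1$ be integers and $0<p\le\infty$. Let $H^p(\mathbb D^n,\mathbb C^m)$ be the space of holomorphic functions $f:\mathbb D^n\to\mathbb C^m$ with $\|f\|_p=\sup_{0\le r<1}\big(\int_{\mathbb T^n}\|f(r\zeta)\|^p\,d\zeta\big)^{1/p}<\infty$ if $p<\infty$, respectively $\|f\|_\infty=\sup_{z\in\mathbb D^n}\|f(z)\|<\infty$ if $p=\infty$, where $\|\cdot\|$ is the Euclidean norm on $\mathbb C^m$ and $d\zeta$ is the normalized Lebesgue measure on the torus $\mathbb T^n$. Equip it with the topology of the (quasi-)norm $\|\cdot\|_p$ if $p<\infty$, and with the weak-star topology if $p=\infty$, that is, the coarsest topology for which $f\mapsto\lim_{r\to1^-}\int_{\mathbb T^n}\sum_k f_k(r\zeta)g_k(\zeta)\,d\zeta$ is continuous for every $g\in L^1(\mathbb T^n,\mathbb C^m)$ (equivalently, the topology induced by $\sigma(L^\infty,L^1)$ through boundary values). Let $\Lambda:H^p(\mathbb D^n,\mathbb C^m)\to\mathbb C$ be a continuous function, not assumed linear and not identically zero, with $\Lambda(0)=0$. For $\mathbb C^m$-valued polynomials $P,Q$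 in $n$ complex variables consider the $\mathbb C^m$-valued polynomial $$R_{P,Q}=(\Lambda(P)-\Lambda(Q))\,\mathbf 1-(P-Q),\qquad \mathbf 1=(1,\dots,1).$$ (a) Suppose that for all $P,Q$ the polynomial $R_{P,Q}$ has a zero in $\mathbb D^n$, that is, $R_{P,Q}(z)=0\in\mathbb C^m$ for some $z\in\mathbb D^n$. Then there exist $w\in\mathbb D^n$ and $1\le k\le m$ such that $\Lambda(f)=\langle f(w),e_k\rangle_{\mathbb C^m}$ for all $f\in H^p(\mathbb D^n,\mathbb C^m)$, where $e_1,\dots,e_m$ is the standard basis of $\mathbb C^m$. (b) The same conclusion holds if, for all $P,Q$, it is only assumed that at least one of the $m$ coordinates of $R_{P,Q}$ has a zero in $\mathbb D^n$ (equivalently, that $R_{P,Q}$ takes a non-invertible value of the algebra $\mathbb C^m$ somewhere in $\mathbb D^n$). -/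

import Mathlib

open MeasureTheory Filter Topology Set
open scoped ENNReal

/-- The open unit polydisc `𝔻ⁿ` in `ℂⁿ`. -/
def polydisc (n : ℕ) : Set (Fin n → ℂ) := {z | ∀ i, ‖z i‖ < 1}

/-- The normalized Lebesgue (Haar) measure on the torus `𝕋ⁿ`, which is parametrized by `x ∈ (ℝ/ℤ)ⁿ`. -/
noncomputable abbrev torusMeasure (n : ℕ) : Measure (UnitAddTorus (Fin n)) :=
  Measure.pi fun _ => AddCircle.haarAddCircle

/-- The point `r ζ` of `ℂⁿ`, where `ζ = (e^{2π i x₁}, …, e^{2π i xₙ})` is the point of the torus `𝕋ⁿ` with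
parameter `x`. -/
noncomputable def torusPoint {n : ℕ} (r : ℝ) (x : UnitAddTorus (Fin n)) : Fin n → ℂ :=
  fun i => (r : ℂ) * (AddCircle.toCircle (x i) : ℂ)

/-- The Hardy (quasi-)norm, with values in `[0, ∞]`: the supremum of `‖f z‖` over `z ∈ 𝔻ⁿ` if `p = ∞`, and
`sup_{0 ≤ r < 1} (∫_{𝕋ⁿ} ‖f (r ζ)‖ ^ p dζ) ^ (1 / p)` if `0 < p < ∞`. -/
noncomputable def hardyENorm (p : ℝ≥0∞) {n m : ℕ} (f : (Fin n → ℂ) → EuclideanSpace ℂ (Fin m)) : ℝ≥0∞ :=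
  if p = ∞ then ⨆ z ∈ polydisc n, ‖f z‖ₑ
  else ⨆ r ∈ Ico (0 : ℝ) 1, eLpNorm (fun x : UnitAddTorus (Fin n) => f (torusPoint r x)) p (torusMeasure n)

lemma torusPoint_mem {n : ℕ} {r : ℝ} (hr : r ∈ Ico (0 : ℝ) 1) (x : UnitAddTorus (Fin n)) :
    torusPoint r x ∈ polydisc n := by
  intro i
  simpa [torusPoint, abs_of_nonneg hr.1, Circle.norm_coe] using hr.2

lemma continuous_torusPoint {n : ℕ} (r : ℝ) : Continuous (torusPoint (n := n) r) := by
  unfold torusPoint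
  refine continuous_pi fun i => continuous_const.mul ?_
  exact continuous_subtype_val.comp (AddCircle.continuous_toCircle.comp (continuous_apply i))

lemma aestronglyMeasurable_torus {n m : ℕ} {f : (Fin n → ℂ) → EuclideanSpace ℂ (Fin m)}
    (hf : DifferentiableOn ℂ f (polydisc n)) {r : ℝ} (hr : r ∈ Ico (0 : ℝ) 1) :
    AEStronglyMeasurable (fun x : UnitAddTorus (Fin n) => f (torusPoint r x)) (torusMeasure n) :=
  (hf.continuousOn.comp_continuous (continuous_torusPoint r) (torusPoint_mem hr)).aestronglyMeasurable

lemma hardyENorm_lt_top_of_bounded (p : ℝ≥0∞) {n m : ℕ} {f : (Fin n → ℂ) → EuclideanSpace ℂ (Fin m)} (C : ℝ)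
    (hC : ∀ z ∈ polydisc n, ‖f z‖ ≤ C) : hardyENorm p f < ∞ := by
  unfold hardyENorm
  split_ifs with hp
  · refine lt_of_le_of_lt (iSup₂_le fun z hz => ?_) (ENNReal.ofReal_lt_top (r := C))
    rw [← ofReal_norm]
    exact ENNReal.ofReal_le_ofReal (hC z hz)
  · refine lt_of_le_of_lt (iSup₂_le fun r hr => ?_) (ENNReal.ofReal_lt_top (r := C))
    refine (eLpNorm_le_of_ae_bound (C := C) (ae_of_all _ fun x => hC _ (torusPoint_mem hr x))).trans ?_
    rw [measure_univ, ENNReal.one_rpow, one_mul]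

/-- The Hardy space `H^p(𝔻ⁿ, ℂᵐ)`, as a space of functions: the holomorphic `f : 𝔻ⁿ → ℂᵐ` of finite Hardy
(quasi-)norm. A function on `𝔻ⁿ` is represented by its extension by `0` to `ℂⁿ`, so that two elements are equal
if and only if they agree on `𝔻ⁿ`. -/
noncomputable def hardySubmodule (p : ℝ≥0∞) (n m : ℕ) :
    Submodule ℂ ((Fin n → ℂ) → EuclideanSpace ℂ (Fin m)) where
  carrier := {f | DifferentiableOn ℂ f (polydisc n) ∧ (∀ z, z ∉ polydisc n → f z = 0) ∧ hardyENorm p f < ∞}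
  zero_mem' := ⟨differentiableOn_const _, fun _ _ => rfl,
    hardyENorm_lt_top_of_bounded p 0 fun _ _ => by simp⟩
  add_mem' := by
    rintro f g ⟨hf, hf0, hfn⟩ ⟨hg, hg0, hgn⟩
    refine ⟨hf.add hg, fun z hz => by simp [hf0 z hz, hg0 z hz], ?_⟩
    unfold hardyENorm at *
    split_ifs at * with hp
    · refine lt_of_le_of_lt (iSup₂_le fun z hz => ?_) (ENNReal.add_lt_top.2 ⟨hfn, hgn⟩)
      exact (enorm_add_le _ _).trans (add_le_add
        (le_iSup₂ (f := fun z (_ : z ∈ polydisc n) => ‖f z‖ₑ) z hz)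
        (le_iSup₂ (f := fun z (_ : z ∈ polydisc n) => ‖g z‖ₑ) z hz))
    · refine lt_of_le_of_lt (iSup₂_le fun r hr => ?_)
        (ENNReal.mul_lt_top (ENNReal.LpAddConst_lt_top p) (ENNReal.add_lt_top.2 ⟨hfn, hgn⟩))
      refine (eLpNorm_add_le' (aestronglyMeasurable_torus hf hr) (aestronglyMeasurable_torus hg hr) p).trans ?_
      gcongr
      · exact le_iSup₂ (f := fun r (_ : r ∈ Ico (0 : ℝ) 1) =>
          eLpNorm (fun x : UnitAddTorus (Fin n) => f (torusPoint r x)) p (torusMeasure n)) r hr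
      · exact le_iSup₂ (f := fun r (_ : r ∈ Ico (0 : ℝ) 1) =>
          eLpNorm (fun x : UnitAddTorus (Fin n) => g (torusPoint r x)) p (torusMeasure n)) r hr
  smul_mem' := by
    rintro c f ⟨hf, hf0, hfn⟩
    refine ⟨hf.const_smul c, fun z hz => by simp [hf0 z hz], ?_⟩
    unfold hardyENorm at *
    split_ifs at * with hp
    · refine lt_of_le_of_lt (iSup₂_le fun z hz => ?_) (ENNReal.mul_lt_top (enorm_lt_top (x := c)) hfn)
      rw [Pi.smul_apply, enorm_smul]
      gcongr
      exact le_iSup₂ (f := fun z (_ : z ∈ polydisc n) => ‖f z‖ₑ) z hz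
    · refine lt_of_le_of_lt (iSup₂_le fun r hr => ?_) (ENNReal.mul_lt_top (enorm_lt_top (x := c)) hfn)
      refine (eLpNorm_const_smul_le (c := c)
        (f := fun x : UnitAddTorus (Fin n) => f (torusPoint r x))).trans ?_
      gcongr
      exact le_iSup₂ (f := fun r (_ : r ∈ Ico (0 : ℝ) 1) =>
          eLpNorm (fun x : UnitAddTorus (Fin n) => f (torusPoint r x)) p (torusMeasure n)) r hr

/-- The Hardy space `H^p(𝔻ⁿ, ℂᵐ)`, `0 < p ≤ ∞`, as a type of its own (so that it carries only the topology that is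
put on it below). -/
def HardySpace (p : ℝ≥0∞) (n m : ℕ) : Type := ↥(hardySubmodule p n m)

noncomputable instance (p : ℝ≥0∞) (n m : ℕ) : AddCommGroup (HardySpace p n m) :=
  inferInstanceAs (AddCommGroup ↥(hardySubmodule p n m))

noncomputable instance (p : ℝ≥0∞) (n m : ℕ) : Module ℂ (HardySpace p n m) :=
  inferInstanceAs (Module ℂ ↥(hardySubmodule p n m))

instance (p : ℝ≥0∞) (n m : ℕ) :
    CoeFun (HardySpace p n m) (fun _ => (Fin n → ℂ) → EuclideanSpace ℂ (Fin m)) :=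
  ⟨fun f => f.1⟩

/-- The topology of the (quasi-)norm (equivalently, for `p < 1`, of the metric `‖f - g‖ ^ p`): a set is open if and
only if it contains a ball around each of its points. -/
abbrev hardyNormTopology (p : ℝ≥0∞) (n m : ℕ) : TopologicalSpace (HardySpace p n m) where
  IsOpen U := ∀ f ∈ U, ∃ ε : ℝ≥0∞, 0 < ε ∧ ∀ g : HardySpace p n m, hardyENorm p ⇑(g - f) < ε → g ∈ U
  isOpen_univ := fun _ _ => ⟨1, one_pos, fun _ _ => mem_univ _⟩
  isOpen_inter := by
    rintro U V hU hV f ⟨hfU, hfV⟩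
    obtain ⟨a, ha, hUa⟩ := hU f hfU
    obtain ⟨b, hb, hVb⟩ := hV f hfV
    exact ⟨min a b, lt_min ha hb, fun g hg =>
      ⟨hUa g (hg.trans_le (min_le_left _ _)), hVb g (hg.trans_le (min_le_right _ _))⟩⟩
  isOpen_sUnion := by
    rintro S hS f ⟨U, hU, hfU⟩
    obtain ⟨a, ha, h⟩ := hS U hU f hfU
    exact ⟨a, ha, fun g hg => ⟨U, hU, h g hg⟩⟩

/-- The duality pairing of `f ∈ H^∞(𝔻ⁿ, ℂᵐ)` with `g ∈ L¹(𝕋ⁿ, ℂᵐ)`,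
`lim_{r → 1-} ∫_{𝕋ⁿ} ∑ₖ fₖ(r ζ) gₖ(ζ) dζ`.
The limit always exists: it is `∫_{𝕋ⁿ} ∑ₖ fₖ*(ζ) gₖ(ζ) dζ`, where `f* ∈ L^∞(𝕋ⁿ, ℂᵐ)` is the boundary function of `f`
(the radial limit almost everywhere, and the weak-star limit of the functions `ζ ↦ f (r ζ)`). -/
noncomputable def hardyPairing {n m : ℕ} (f : (Fin n → ℂ) → EuclideanSpace ℂ (Fin m))
    (g : UnitAddTorus (Fin n) → EuclideanSpace ℂ (Fin m)) : ℂ :=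
  limUnder (𝓝[<] (1 : ℝ)) fun r => ∫ x : UnitAddTorus (Fin n), ∑ k, f (torusPoint r x) k * g x k ∂torusMeasure n

/-- The weak-star topology (used for `p = ∞` only) of `H^∞(𝔻ⁿ, ℂᵐ)`, that is, the topology induced by `σ(L^∞, L¹)` through the embedding
`f ↦ f*` into `L^∞(𝕋ⁿ, ℂᵐ) = L¹(𝕋ⁿ, ℂᵐ)*`: the coarsest topology that makes the pairing with every `g ∈ L¹`
continuous. -/
noncomputable abbrev hardyWeakStarTopology (p : ℝ≥0∞) (n m : ℕ) : TopologicalSpace (HardySpace p n m) :=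
  ⨅ g : {g : UnitAddTorus (Fin n) → EuclideanSpace ℂ (Fin m) // Integrable g (torusMeasure n)},
    TopologicalSpace.induced (fun f : HardySpace p n m => hardyPairing f g.1) inferInstance

/-- `H^p` carries its (quasi-)norm topology if `p < ∞` and the weak-star topology if `p = ∞`. -/
noncomputable instance (p : ℝ≥0∞) (n m : ℕ) : TopologicalSpace (HardySpace p n m) :=
  if p = ∞ then hardyWeakStarTopology p n m else hardyNormTopology p n m

/-- `ℂᵐ`-valued polynomials in `n` variables, as `m`-tuples of complex polynomials. It is a complex algebra under
coordinatewise operations, whose identity is the constant polynomial `𝟏 = (1, …, 1)`. -/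
abbrev VecPoly (n m : ℕ) : Type := Fin m → MvPolynomial (Fin n) ℂ

/-- The value of a `ℂᵐ`-valued polynomial at a point of `ℂⁿ`. -/
noncomputable def VecPoly.eval {n m : ℕ} (P : VecPoly n m) (z : Fin n → ℂ) : EuclideanSpace ℂ (Fin m) :=
  WithLp.toLp 2 fun k => MvPolynomial.eval z (P k)

lemma VecPoly.differentiable_eval {n m : ℕ} (P : VecPoly n m) : Differentiable ℂ P.eval := by
  rw [differentiable_euclidean]
  intro k
  change Differentiable ℂ fun z => MvPolynomial.eval z (P k)
  induction P k using MvPolynomial.induction_on with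
  | C a => simp
  | add p q hp hq => simpa using hp.fun_add hq
  | mul_X p i hp => simpa using hp.fun_mul (differentiable_apply i)

open Classical in
/-- A `ℂᵐ`-valued polynomial, restricted to `𝔻ⁿ`, as an element of `H^p(𝔻ⁿ, ℂᵐ)`. -/
noncomputable def VecPoly.toHardy (p : ℝ≥0∞) {n m : ℕ} (P : VecPoly n m) : HardySpace p n m :=
  ⟨(polydisc n).indicator P.eval, by
    have hb : ∃ C : ℝ, ∀ z ∈ polydisc n, ‖P.eval z‖ ≤ C := by
      obtain ⟨C, hC⟩ := (isCompact_closedBall (0 : Fin n → ℂ) 1).exists_bound_of_continuousOn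
        P.differentiable_eval.continuous.continuousOn
      refine ⟨C, fun z hz => hC z ?_⟩
      rw [mem_closedBall_zero_iff, pi_norm_le_iff_of_nonneg zero_le_one]
      exact fun i => (hz i).le
    obtain ⟨C, hC⟩ := hb
    refine ⟨P.differentiable_eval.differentiableOn.congr fun z hz => indicator_of_mem hz _,
      fun z hz => indicator_of_notMem hz _, hardyENorm_lt_top_of_bounded p C fun z hz => ?_⟩
    rw [indicator_of_mem hz]
    exact hC z hz⟩

/-! A zero of a coordinate of `R_{P,Q}` says that `Λ(P) - Λ(Q)` is the value of `P - Q` under one of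
the characters `VecPoly.evalHom`. So (a) follows from (b), and (b) is a Kowalski–Słodkowski problem
on the algebra of polynomials (`exists_algHom_of_spectral`) followed by a density argument.

Linearity: on `a + span(1, x, …, x^N)` the function is Lipschitz, hence differentiable almost
everywhere. Its derivative sends a polynomial `v` into the closure of the values of `v` on a set
bounded by `M`, so it vanishes at no nonzero multiple of `(1 - tX)^N` with `|t| < 1/M`. Its
conjugate-linear part is therefore dominated by its complex-linear part along this family, and a
Schwarz-type bound in `t` makes the `∂̄`-derivative in the direction `x` at most `2M/N`
(`norm_dbar_le_of_mem_closure`). Averaging turns this into a bound for the rectangle integrals of `ζ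
↦ F(a + ζx)`. As `N` is arbitrary they vanish, and Morera and Liouville make `F` affine on complex
lines.

Multiplicativity (Gleason–Kahane–Żelazko): for linear `F`, the reciprocal roots of the polynomial `t
↦ F((1 - tx)^N)` are values of `x`. Comparing coefficients with power sums gives `F(x²) = F(x)²` up
to `O(1/N)`. The resulting character is an evaluation (`VecPoly.exists_eq_eval_of_algHom`).

Density: the dilates `f_r` must converge to `f`, also for `p < 1`. Comparing `‖f‖^a` with the
modulus of a zero-free entire function and using Parseval, the squared `L²`-distance between
`‖f_r‖^a` and `‖f_s‖^a` is at most three times the growth of the mean of `‖f‖^{2a}`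
(`integral_torus_sq_sub_norm_rpow_le`). These means are thus monotone, and bounded means give a
Cauchy family. Applied to `f - c` for constants `c`, this makes `f_r` itself Cauchy in `L^p`, since
finitely many distances `‖y - c‖` separate points. Interpolation at roots of unity approximates
`f_r` uniformly by polynomials. For `p = ∞`, convergence in `L¹` and boundedness give weak-star
convergence. -/

/-! ### Rectangle integrals of Lipschitz functions with small `∂̄`-derivative. -/

/-- A real-differentiable function with small `∂̄`-derivative has small integrals over rectangles. -/
lemma norm_wedgeIntegral_add_wedgeIntegral_le {h : ℂ → ℂ} (hd : Differentiable ℝ h) {ε : ℝ}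
    (hε : ∀ z, ‖fderiv ℝ h z 1 + Complex.I * fderiv ℝ h z Complex.I‖ ≤ ε) (z w : ℂ) :
    ‖Complex.wedgeIntegral z w h + Complex.wedgeIntegral w z h‖
      ≤ ε * |w.im - z.im| * |w.re - z.re| := by
  have hpt : ∀ x : ℂ, ‖Complex.I • fderiv ℝ h x 1 - fderiv ℝ h x Complex.I‖ ≤ ε := by
    intro x
    -- The integrand of Green's formula is `I` times the `∂̄`-expression.
    have : Complex.I • fderiv ℝ h x 1 - fderiv ℝ h x Complex.I =
        Complex.I * (fderiv ℝ h x 1 + Complex.I * fderiv ℝ h x Complex.I) := by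
      linear_combination (-fderiv ℝ h x Complex.I) * Complex.I_mul_I
    rw [this, norm_mul, Complex.norm_I, one_mul]
    exact hε x
  have hint : IntegrableOn (fun z => Complex.I • fderiv ℝ h z 1 - fderiv ℝ h z Complex.I)
      (Set.uIcc z.re w.re ×ℂ Set.uIcc z.im w.im) volume := by
    have hc : IsCompact (Set.uIcc z.re w.re ×ℂ Set.uIcc z.im w.im) :=
      isCompact_uIcc.reProdIm isCompact_uIcc
    refine Measure.integrableOn_of_bounded (M := ε) hc.measure_lt_top.ne ?_
      (ae_of_all _ fun x => hpt x)
    exact ((measurable_fderiv_apply_const ℝ h 1).const_smul Complex.I |>.sub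
      (measurable_fderiv_apply_const ℝ h Complex.I)).aestronglyMeasurable
  have key := Complex.integral_boundary_rect_of_differentiableOn_real h z w
    hd.differentiableOn hint
  rw [Complex.wedgeIntegral_add_wedgeIntegral_eq, key]
  refine intervalIntegral.norm_integral_le_of_norm_le_const fun x _ => ?_
  exact intervalIntegral.norm_integral_le_of_norm_le_const fun y _ => hpt _

lemma norm_wedgeIntegral_le {h : ℂ → ℂ} {C : ℝ} (hC : ∀ z, ‖h z‖ ≤ C) (z w : ℂ) :
    ‖Complex.wedgeIntegral z w h‖ ≤ C * |w.re - z.re| + C * |w.im - z.im| := by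
  unfold Complex.wedgeIntegral
  refine (norm_add_le _ _).trans (add_le_add ?_ ?_)
  · exact intervalIntegral.norm_integral_le_of_norm_le_const fun x _ => hC _
  · rw [norm_smul, Complex.norm_I, one_mul]
    exact intervalIntegral.norm_integral_le_of_norm_le_const fun x _ => hC _

lemma wedgeIntegral_sub {f g : ℂ → ℂ} (hf : Continuous f) (hg : Continuous g) (z w : ℂ) :
    Complex.wedgeIntegral z w (fun x => f x - g x) =
      Complex.wedgeIntegral z w f - Complex.wedgeIntegral z w g := by
  unfold Complex.wedgeIntegral
  rw [intervalIntegral.integral_sub, intervalIntegral.integral_sub, smul_sub]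
  · ring
  all_goals exact Continuous.intervalIntegrable (by fun_prop) _ _

/-- The average of a Lipschitz function over a small ball is differentiable, and its `∂̄`-derivative in a direction
is controlled by that of the function at the points where the latter is differentiable. -/
lemma exists_differentiable_approx {E : Type*} [NormedAddCommGroup E] [NormedSpace ℂ E]
    [FiniteDimensional ℝ E] {G : E → ℂ} {K : NNReal} (hG : LipschitzWith K G) (e : E) {ε : ℝ}
    (hε : ∀ v, DifferentiableAt ℝ G v →
      ‖fderiv ℝ G v e + Complex.I * fderiv ℝ G v (Complex.I • e)‖ ≤ ε) (a : E) {δ : ℝ} (hδ : 0 < δ) :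
    ∃ h : ℂ → ℂ, Differentiable ℝ h ∧
      (∀ z, ‖fderiv ℝ h z 1 + Complex.I * fderiv ℝ h z Complex.I‖ ≤ ε) ∧
      ∀ z, ‖h z - G (a + z • e)‖ ≤ K * δ := by
  borelize E
  let ν : Measure E := Measure.addHaar
  set μ : Measure E := ProbabilityTheory.cond ν (Metric.ball 0 1) with hμ
  have hb0 : ν (Metric.ball (0 : E) 1) ≠ 0 := (Metric.measure_ball_pos ν 0 one_pos).ne'
  have hbt : ν (Metric.ball (0 : E) 1) ≠ ∞ := measure_ball_lt_top.ne
  have : IsProbabilityMeasure μ := ProbabilityTheory.cond_isProbabilityMeasure_of_finite hb0 hbt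
  have hac : μ ≪ ν := ProbabilityTheory.cond_absolutelyContinuous
  have hball : ∀ᵐ w ∂μ, ‖w‖ ≤ 1 := by
    have := ProbabilityTheory.ae_cond_mem (μ := ν) (s := Metric.ball (0 : E) 1) measurableSet_ball
    filter_upwards [this] with w hw
    exact (mem_ball_zero_iff.1 hw).le
  let Le : ℂ →L[ℝ] E := (ContinuousLinearMap.toSpanSingleton ℂ e).restrictScalars ℝ
  have hLe : ∀ z, Le z = z • e := fun z => rfl
  let F : ℂ → E → ℂ := fun z w => G (a + z • e + δ • w)
  let F' : ℂ → E → ℂ →L[ℝ] ℂ := fun z w => (fderiv ℝ G (a + z • e + δ • w)).comp Le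
  have hcont : ∀ z, Continuous (F z) := fun z => hG.continuous.comp (by fun_prop)
  have hFpm : ∀ z : ℂ, AEStronglyMeasurable (F' z) μ := by
    intro z
    have h1 : Measurable fun w : E => fderiv ℝ G (a + z • e + δ • w) :=
      (measurable_fderiv ℝ G).comp (show Continuous fun w : E => a + z • e + δ • w by fun_prop).measurable
    have h2 : Continuous fun T : E →L[ℝ] ℂ => T.comp Le := by fun_prop
    exact h2.comp_aestronglyMeasurable h1.aestronglyMeasurable
  have hdiff : ∀ z : ℂ, ∀ᵐ w ∂μ, DifferentiableAt ℝ G (a + z • e + δ • w) := by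
    intro z
    have hl : LipschitzWith (K * (Real.nnabs δ)) (F z) := by
      refine hG.comp (LipschitzWith.of_dist_le_mul fun x y => ?_)
      rw [dist_add_left, dist_eq_norm, dist_eq_norm, ← smul_sub, norm_smul]
      simp
    -- Rademacher's theorem in the variable `w`, with `z` fixed. The affine substitution carries
    -- differentiability back to `G`.
    filter_upwards [hac.ae_le (hl.ae_differentiableAt (μ := ν))] with w hw
    have hc : (δ⁻¹ : ℝ) • (a + z • e + δ • w - (a + z • e)) = w := by
      simp [smul_smul, hδ.ne']
    have h3 : DifferentiableAt ℝ (F z ∘ fun y : E => δ⁻¹ • (y - (a + z • e))) (a + z • e + δ • w) := by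
      refine DifferentiableAt.comp _ (by rw [hc]; exact hw) (by fun_prop)
    convert h3 using 1
    ext y
    simp [F, smul_smul, hδ.ne']
  have hFint : ∀ z, Integrable (F z) μ := by
    intro z
    refine Integrable.of_bound (C := ‖G (a + z • e)‖ + K * δ) (hcont z).aestronglyMeasurable ?_
    filter_upwards [hball] with w hw
    have := hG.dist_le_mul (a + z • e + δ • w) (a + z • e)
    rw [dist_eq_norm, dist_eq_norm, add_sub_cancel_left, norm_smul, Real.norm_of_nonneg hδ.le] at this
    have h4 : ‖F z w‖ ≤ ‖G (a + z • e)‖ + ‖F z w - G (a + z • e)‖ := by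
      simpa using norm_add_le (G (a + z • e)) (F z w - G (a + z • e))
    refine h4.trans (add_le_add le_rfl (this.trans ?_))
    gcongr
    nlinarith
  have hmain : ∀ z, Integrable (F' z) μ ∧
      HasFDerivAt (fun z => ∫ w, F z w ∂μ) (∫ w, F' z w ∂μ) z := by
    intro z
    -- With a Lipschitz bound as domination, differentiability is needed only at `z` itself, for
    -- almost every `w`.
    refine hasFDerivAt_integral_of_dominated_loc_of_lip (s := univ) (bound := fun _ => K * ‖e‖)
      univ_mem (.of_forall fun x => (hcont x).aestronglyMeasurable) (hFint z) (hFpm z)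
      (ae_of_all _ fun w => ?_) (integrable_const _) ?_
    · rw [lipschitzOnWith_univ]
      refine LipschitzWith.of_dist_le_mul fun x y => ?_
      refine (hG.dist_le_mul _ _).trans (le_of_eq ?_)
      rw [dist_add_right, dist_add_left, dist_eq_norm, dist_eq_norm, ← sub_smul, norm_smul]
      simp
      ring
    · filter_upwards [hdiff z] with w hw
      have h5 : HasFDerivAt (fun x : ℂ => a + x • e + δ • w) Le z :=
        ((Le.hasFDerivAt (x := z)).const_add a).add_const _
      exact hw.hasFDerivAt.comp z h5
  have hder : ∀ z, fderiv ℝ (fun z => ∫ w, F z w ∂μ) z = ∫ w, F' z w ∂μ := fun z => (hmain z).2.fderiv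
  refine ⟨fun z => ∫ w, F z w ∂μ, fun z => (hmain z).2.differentiableAt, fun z => ?_, fun z => ?_⟩
  · rw [hder, ContinuousLinearMap.integral_apply (hmain z).1, ContinuousLinearMap.integral_apply (hmain z).1,
      ← integral_const_mul, ← integral_add]
    · have := norm_integral_le_of_norm_le_const (μ := μ)
        (f := fun w => F' z w 1 + Complex.I * F' z w Complex.I) (C := ε) ?_
      · simpa using this
      · filter_upwards [hdiff z] with w hw
        simpa [F', hLe] using hε _ hw
    · exact (hmain z).1.apply_continuousLinearMap 1
    · exact ((hmain z).1.apply_continuousLinearMap Complex.I).const_mul _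
  · have h6 : (∫ w, F z w ∂μ) - G (a + z • e) = ∫ w, (F z w - G (a + z • e)) ∂μ := by
      rw [integral_sub (hFint z) (integrable_const _)]
      simp
    rw [h6]
    have := norm_integral_le_of_norm_le_const (μ := μ)
        (f := fun w => F z w - G (a + z • e)) (C := K * δ) ?_
    · simpa using this
    · filter_upwards [hball] with w hw
      have := hG.dist_le_mul (a + z • e + δ • w) (a + z • e)
      rw [dist_eq_norm, dist_eq_norm, add_sub_cancel_left, norm_smul, Real.norm_of_nonneg hδ.le] at this
      refine this.trans ?_
      gcongr
      nlinarith

/-- The complex line may lie entirely in the null set where `G` is not differentiable, so the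
estimate is made for averages over balls of radius `δ` in `E`. These differ from `G` by at most `K *
δ` on two paths of length `S`, and `δ` tends to `0`. -/
lemma norm_wedgeIntegral_lipschitz_le {E : Type*} [NormedAddCommGroup E] [NormedSpace ℂ E]
    [FiniteDimensional ℝ E] {G : E → ℂ} {K : NNReal} (hG : LipschitzWith K G) (e : E) {ε : ℝ}
    (hε : ∀ v, DifferentiableAt ℝ G v →
      ‖fderiv ℝ G v e + Complex.I * fderiv ℝ G v (Complex.I • e)‖ ≤ ε) (a : E) (z w : ℂ) :
    ‖Complex.wedgeIntegral z w (fun x => G (a + x • e)) +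
      Complex.wedgeIntegral w z (fun x => G (a + x • e))‖ ≤ ε * |w.im - z.im| * |w.re - z.re| := by
  set g : ℂ → ℂ := fun x => G (a + x • e)
  have hg : Continuous g := hG.continuous.comp (by fun_prop)
  set S : ℝ := |w.re - z.re| + |w.im - z.im| with hS
  have key : ∀ δ : ℝ, 0 < δ → ‖Complex.wedgeIntegral z w g + Complex.wedgeIntegral w z g‖ ≤
      ε * |w.im - z.im| * |w.re - z.re| + 2 * K * S * δ := by
    intro δ hδ
    obtain ⟨h, hd, hb, hc⟩ := exists_differentiable_approx hG e hε a hδ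
    have h1 := norm_wedgeIntegral_add_wedgeIntegral_le hd hb z w
    have h2 := norm_wedgeIntegral_le hc z w
    have h3 := norm_wedgeIntegral_le hc w z
    have hdc : Continuous h := hd.continuous
    rw [wedgeIntegral_sub hdc hg] at h2 h3
    rw [abs_sub_comm z.re, abs_sub_comm z.im] at h3
    have : Complex.wedgeIntegral z w g + Complex.wedgeIntegral w z g =
      (Complex.wedgeIntegral z w h + Complex.wedgeIntegral w z h) -
      (Complex.wedgeIntegral z w h - Complex.wedgeIntegral z w g) -
      (Complex.wedgeIntegral w z h - Complex.wedgeIntegral w z g) := by ring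
    rw [this]
    refine (norm_sub_le _ _).trans ?_
    have h4 := norm_sub_le (Complex.wedgeIntegral z w h + Complex.wedgeIntegral w z h)
      (Complex.wedgeIntegral z w h - Complex.wedgeIntegral z w g)
    rw [hS]
    linarith
  have hlim : Tendsto (fun δ : ℝ => ε * |w.im - z.im| * |w.re - z.re| + 2 * K * S * δ) (𝓝[>] 0)
      (𝓝 (ε * |w.im - z.im| * |w.re - z.re| + 2 * K * S * 0)) :=
    (Continuous.tendsto (by fun_prop) _).mono_left nhdsWithin_le_nhds
  rw [mul_zero, add_zero] at hlim
  exact ge_of_tendsto hlim (eventually_mem_nhdsWithin.mono fun δ hδ => key δ hδ)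

/-! ### Complex-linear and conjugate-linear parts of real-linear functionals. -/

section RealLinear

variable {V : Type*} [AddCommGroup V] [Module ℂ V]

lemma LinearMap.map_complex_smul_of_real (φ : V →ₗ[ℝ] ℂ) (c : ℂ) (v : V) :
    φ (c • v) = c.re * φ v + c.im * φ (Complex.I • v) := by
  have : c • v = c.re • v + c.im • (Complex.I • v) := by
    rw [← Complex.coe_smul c.re v, ← Complex.coe_smul c.im, smul_smul, ← add_smul, Complex.re_add_im]
  rw [this, map_add, map_smul, map_smul, Complex.real_smul, Complex.real_smul]

/-- Twice the complex-linear part of a real-linear functional. -/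
noncomputable def LinearMap.complexLinearPart (φ : V →ₗ[ℝ] ℂ) : V →ₗ[ℂ] ℂ where
  toFun v := φ v - Complex.I * φ (Complex.I • v)
  map_add' u v := by rw [smul_add, map_add, map_add]; ring
  map_smul' c v := by
    simp only [RingHom.id_apply, smul_eq_mul, smul_comm Complex.I c v, φ.map_complex_smul_of_real c]
    have h : φ (Complex.I • Complex.I • v) = -φ v := by
      rw [smul_smul, Complex.I_mul_I, neg_one_smul, map_neg]
    rw [h]
    conv_rhs => rw [← Complex.re_add_im c]
    linear_combination ((c.im : ℂ) * φ (Complex.I • v)) * Complex.I_mul_I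

/-- The conjugate of twice the conjugate-linear part of a real-linear functional. -/
noncomputable def LinearMap.conjLinearPart (φ : V →ₗ[ℝ] ℂ) : V →ₗ[ℂ] ℂ where
  toFun v := starRingEnd ℂ (φ v + Complex.I * φ (Complex.I • v))
  map_add' u v := by simp only [smul_add, map_add, map_mul]; ring
  map_smul' c v := by
    simp only [RingHom.id_apply, smul_eq_mul, smul_comm Complex.I c v, φ.map_complex_smul_of_real c]
    have h : φ (Complex.I • Complex.I • v) = -φ v := by
      rw [smul_smul, Complex.I_mul_I, neg_one_smul, map_neg]
    rw [h, ← Complex.conj_conj c, ← map_mul, Complex.conj_conj]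
    congr 1
    have hc : starRingEnd ℂ c = c.re - c.im * Complex.I := by
      apply Complex.ext <;> simp
    rw [hc]
    linear_combination ((c.im : ℂ) * φ (Complex.I • v)) * Complex.I_mul_I

lemma LinearMap.two_mul_apply_smul (φ : V →ₗ[ℝ] ℂ) (c : ℂ) (v : V) :
    2 * φ (c • v) = c * φ.complexLinearPart v + starRingEnd ℂ (c * φ.conjLinearPart v) := by
  have h1 := φ.complexLinearPart.map_smul c v
  have h2 := φ.conjLinearPart.map_smul c v
  rw [smul_eq_mul] at h1 h2
  rw [← h1, ← h2]
  simp only [complexLinearPart, conjLinearPart, LinearMap.coe_mk, AddHom.coe_mk, Complex.conj_conj]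
  ring

/-- If a real-linear functional vanishes on no unimodular multiple of `v`, then its complex-linear and conjugate-linear
parts have different moduli at `v`. -/
lemma LinearMap.norm_complexLinearPart_ne (φ : V →ₗ[ℝ] ℂ) (v : V)
    (h : ∀ c : ℂ, c ≠ 0 → φ (c • v) ≠ 0) : ‖φ.complexLinearPart v‖ ≠ ‖φ.conjLinearPart v‖ := by
  intro heq
  set a := φ.complexLinearPart v
  set b := φ.conjLinearPart v
  have hne : ∀ c : ℂ, c ≠ 0 → c * a + starRingEnd ℂ (c * b) ≠ 0 := fun c hc h0 =>
    h c hc (by simpa using (φ.two_mul_apply_smul c v).trans h0)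
  by_cases ha : a = 0
  · have hb : b = 0 := by rw [ha, norm_zero] at heq; exact norm_eq_zero.1 heq.symm
    exact hne 1 one_ne_zero (by simp [ha, hb])
  -- The equation `c a = -conj(c b)`, multiplied by `c`, reads `c² a = -|c|² conj b`. It is solved
  -- by `c² = -conj(a b)`, for which `|c|² = |a|² = a conj a`.
  · obtain ⟨c, hc⟩ := IsSepClosed.exists_pow_nat_eq (-(starRingEnd ℂ (a * b))) 2
    by_cases hb : b = 0
    · rw [hb, norm_zero] at heq
      exact ha (norm_eq_zero.1 heq)
    have hc0 : c ≠ 0 := by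
      rintro rfl
      simp [ha, hb] at hc
    have hcn : ‖c‖ ^ 2 = ‖a‖ ^ 2 := by
      rw [← norm_pow, hc, norm_neg, RCLike.norm_conj, norm_mul, ← heq, sq]
    have h1 : c * starRingEnd ℂ c = a * starRingEnd ℂ a := by
      rw [Complex.mul_conj, Complex.mul_conj, Complex.normSq_eq_norm_sq, Complex.normSq_eq_norm_sq, hcn]
    apply hne c hc0
    have h2 : c * (c * a + starRingEnd ℂ (c * b)) = 0 := by
      rw [map_mul]
      rw [map_mul] at hc
      linear_combination a * hc + starRingEnd ℂ b * h1
    exact (mul_eq_zero.1 h2).resolve_left hc0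

end RealLinear

/-! ### The `∂̄`-estimate along the powers `(1 - tX)^N`. -/

/-- The coefficients of the polynomial `(1 - t X) ^ N`. -/
noncomputable def oneSubPowCoeff (N : ℕ) (t : ℂ) : Fin (N + 1) → ℂ := fun i => (-t) ^ (i : ℕ) * N.choose i

lemma sum_oneSubPowCoeff (N : ℕ) (t l : ℂ) :
    ∑ i, oneSubPowCoeff N t i * l ^ (i : ℕ) = (1 - t * l) ^ N := by
  have := add_pow (-t * l) 1 N
  rw [Finset.sum_range] at this
  rw [show 1 - t * l = -t * l + 1 by ring, this]
  refine Finset.sum_congr rfl fun i _ => ?_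
  simp [oneSubPowCoeff]
  ring

/-- Differentiation at `t = 0` extracts the coefficient vector of `X` with the factor `-N`. This
factor is the source of the decay in `N`. -/
lemma linearMap_oneSubPowCoeff {N : ℕ} (hN : 1 ≤ N) (γ : (Fin (N + 1) → ℂ) →ₗ[ℂ] ℂ) :
    γ (oneSubPowCoeff N 0) = γ (Pi.single 0 1) ∧
      Differentiable ℂ (fun t => γ (oneSubPowCoeff N t)) ∧
      deriv (fun t => γ (oneSubPowCoeff N t)) 0 = -(N * γ (Pi.single ⟨1, by omega⟩ 1)) := by
  have h0 : oneSubPowCoeff N 0 = Pi.single 0 1 := by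
    ext i
    rcases Fin.eq_zero_or_eq_succ i with rfl | ⟨j, rfl⟩
    · simp [oneSubPowCoeff]
    · simp [oneSubPowCoeff]
  have hd : ∀ t, HasDerivAt (oneSubPowCoeff N)
      (fun i : Fin (N + 1) => ((i : ℕ) : ℂ) * (-t) ^ ((i : ℕ) - 1) * (-1) * N.choose i) t := by
    intro t
    rw [hasDerivAt_pi]
    intro i
    exact ((hasDerivAt_neg t).fun_pow (i : ℕ)).mul_const _
  have hd0 : (fun i : Fin (N + 1) => ((i : ℕ) : ℂ) * (-0) ^ ((i : ℕ) - 1) * (-1) * N.choose i)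
      = (-(N : ℂ)) • (Pi.single ⟨1, by omega⟩ 1 : Fin (N + 1) → ℂ) := by
    ext i
    by_cases hi : i = ⟨1, by omega⟩
    · subst hi
      simp
    · have hi' : (i : ℕ) ≠ 1 := fun h => hi (Fin.ext h)
      rw [Pi.smul_apply, Pi.single_eq_of_ne hi, smul_zero]
      rcases Nat.eq_zero_or_pos (i : ℕ) with h | h
      · simp [h]
      · rw [neg_zero, zero_pow (by omega)]
        simp
  have hγ : ∀ t, HasDerivAt (fun t => γ (oneSubPowCoeff N t)) _ t := fun t =>
    (γ.toContinuousLinearMap.hasFDerivAt.comp_hasDerivAt t (hd t))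
  refine ⟨by rw [h0], fun t => (hγ t).differentiableAt, ?_⟩
  rw [(hγ 0).deriv, hd0]
  simp

/-- A real-linear functional on the polynomials of degree at most `N` whose value at each polynomial lies in the closure
of the range of that polynomial over a bounded set is nearly complex-linear in the direction of `X`. -/
lemma norm_dbar_le_of_mem_closure {N : ℕ} (hN : 1 ≤ N) {S : Set ℂ} {M : ℝ} (hM : 0 < M)
    (hS : ∀ l ∈ S, ‖l‖ ≤ M) (φ : (Fin (N + 1) → ℂ) →ₗ[ℝ] ℂ)
    (hφ : ∀ v, φ v ∈ closure ((fun l : ℂ => ∑ i : Fin (N + 1), v i * l ^ (i : ℕ)) '' S)) :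
    ‖φ (Pi.single ⟨1, by omega⟩ 1) + Complex.I * φ (Complex.I • Pi.single ⟨1, by omega⟩ 1)‖
      ≤ 2 * M / N := by
  set e1 : Fin (N + 1) → ℂ := Pi.single ⟨1, by omega⟩ 1 with he1
  set α := φ.complexLinearPart with hα
  set β := φ.conjLinearPart with hβ
  obtain ⟨hp0, hpd, -⟩ := linearMap_oneSubPowCoeff hN α
  obtain ⟨hq0, hqd, hq1⟩ := linearMap_oneSubPowCoeff hN β
  set p := fun t => α (oneSubPowCoeff N t) with hp
  set q := fun t => β (oneSubPowCoeff N t) with hq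
  have hconst : ∀ c : ℂ, φ (c • Pi.single 0 1) = c := by
    intro c
    have h1 := hφ (c • Pi.single 0 1)
    have h2 : (fun l : ℂ => ∑ i : Fin (N + 1), (c • Pi.single 0 1 : Fin (N + 1) → ℂ) i * l ^ (i : ℕ)) = fun _ => c := by
      ext l
      rw [Finset.sum_eq_single 0]
      · simp
      · intro i _ hi
        simp [Pi.single_eq_of_ne hi]
      · simp
    rw [h2] at h1
    have h3 : (fun _ : ℂ => c) '' S ⊆ {c} := by
      rintro _ ⟨_, _, rfl⟩; rfl
    simpa using closure_mono h3 h1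
  have hp0' : p 0 = 2 := by
    rw [hp]
    dsimp only
    rw [hp0]
    change φ _ - Complex.I * φ _ = 2
    rw [hconst, ← one_smul ℂ (Pi.single 0 1 : Fin (N + 1) → ℂ), hconst, Complex.I_mul_I]
    norm_num
  have hq0' : q 0 = 0 := by
    rw [hq]
    dsimp only
    rw [hq0]
    change starRingEnd ℂ (φ _ + Complex.I * φ _) = 0
    rw [hconst, ← one_smul ℂ (Pi.single 0 1 : Fin (N + 1) → ℂ), hconst, Complex.I_mul_I]
    norm_num
  -- On `S` the modulus of `c (1 - t l)^N` is at least `‖c‖ (1 - ‖t‖ M)^N > 0`, so `0` is not in the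
  -- closure of its values.
  have hne : ∀ t ∈ Metric.ball (0 : ℂ) (1 / M), ‖p t‖ ≠ ‖q t‖ := by
    intro t ht
    rw [mem_ball_zero_iff, lt_div_iff₀ hM] at ht
    refine φ.norm_complexLinearPart_ne _ fun c hc h0 => ?_
    have h1 := hφ (c • oneSubPowCoeff N t)
    rw [h0] at h1
    have hpos : 0 < ‖c‖ * (1 - ‖t‖ * M) ^ N := mul_pos (norm_pos_iff.2 hc) (pow_pos (by linarith) _)
    obtain ⟨_, ⟨l, hl, rfl⟩, hlt⟩ := Metric.mem_closure_iff.1 h1 _ hpos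
    have h2 : ∑ i : Fin (N + 1), (c • oneSubPowCoeff N t) i * l ^ (i : ℕ) = c * (1 - t * l) ^ N := by
      rw [← sum_oneSubPowCoeff, Finset.mul_sum]
      exact Finset.sum_congr rfl fun i _ => by simp [mul_assoc]
    rw [dist_zero_left] at hlt
    beta_reduce at hlt
    rw [h2, norm_mul, norm_pow] at hlt
    have h3 : 1 - ‖t‖ * M ≤ ‖1 - t * l‖ := by
      have := norm_sub_norm_le (1 : ℂ) (t * l)
      rw [norm_one, norm_mul] at this
      have := mul_le_mul_of_nonneg_left (hS l hl) (norm_nonneg t)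
      linarith
    have := mul_le_mul_of_nonneg_left (pow_le_pow_left₀ (by linarith) h3 N) (norm_nonneg c)
    linarith
  -- The moduli never agree on the connected disc and `‖q‖ < ‖p‖` holds at its centre.
  have hlt : ∀ t ∈ Metric.ball (0 : ℂ) (1 / M), ‖q t‖ < ‖p t‖ := by
    intro t ht
    by_contra hcon
    have hpre : IsPreconnected (Metric.ball (0 : ℂ) (1 / M)) := (convex_ball _ _).isPreconnected
    obtain ⟨s, hs, hs0⟩ := hpre.intermediate_value₂ (f := fun t => ‖q t‖) (g := fun t => ‖p t‖)
      (Metric.mem_ball_self (by positivity)) ht hqd.continuous.norm.continuousOn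
      hpd.continuous.norm.continuousOn (by simp [hp0', hq0']) (not_lt.1 hcon)
    exact hne s hs hs0.symm
  have hpne : ∀ t ∈ Metric.ball (0 : ℂ) (1 / M), p t ≠ 0 := fun t ht =>
    norm_pos_iff.1 ((norm_nonneg _).trans_lt (hlt t ht))
  have h0mem : (0 : ℂ) ∈ Metric.ball (0 : ℂ) (1 / M) := Metric.mem_ball_self (by positivity)
  -- The Schwarz-type bound for `q / p`, which maps the disc of radius `1 / M` to the closed unit
  -- disc and `0` to `0`.
  have hb := Complex.norm_deriv_le_div_of_mapsTo_ball (f := fun t => q t / p t) (c := 0) (R₁ := 1 / M) (R₂ := 1)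
    (hqd.differentiableOn.div hpd.differentiableOn hpne) (fun t ht => by
      rw [mem_closedBall_iff_norm, hq0', zero_div, sub_zero, norm_div]
      exact (div_le_one ((norm_nonneg _).trans_lt (hlt t ht))).2 (hlt t ht).le) (by positivity)
  have hder : deriv (fun t => q t / p t) 0 = -(N * β e1) / 2 := by
    have := ((hqd 0).hasDerivAt.div (hpd 0).hasDerivAt (hpne 0 h0mem)).deriv
    rw [show (fun t => q t / p t) = q / p from rfl, this, hq1, hq0', hp0']
    ring
  rw [hder, norm_div, norm_neg, norm_mul, one_div_one_div, Complex.norm_natCast, Complex.norm_two] at hb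
  have hbe : ‖β e1‖ = ‖φ e1 + Complex.I * φ (Complex.I • e1)‖ := RCLike.norm_conj _
  rw [← hbe]
  have hNpos : (0 : ℝ) < N := by exact_mod_cast hN
  rw [le_div_iff₀ hNpos]
  rw [div_le_iff₀ two_pos] at hb
  linarith

/-! ### The Kowalski–Słodkowski theorem. -/

section KowalskiSlodkowski

variable {A Ω : Type*} [CommRing A] [Algebra ℂ A] {ev : Ω → A →ₐ[ℂ] ℂ} {F : A → ℂ}

/-- The line `ζ ↦ a + ζ x` does not depend on `N`, but it sits inside the polynomials in `x` of
every degree `N`. Each `N` bounds the rectangle integral by a multiple of `1 / N`. -/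
lemma wedgeIntegral_add_eq_zero_of_spectral (hbd : ∀ a, ∃ C, ∀ x, ‖ev x a‖ ≤ C)
    (hF : ∀ a b, ∃ x, F a - F b = ev x (a - b)) (a x : A) (z w : ℂ) :
    Complex.wedgeIntegral z w (fun ζ => F (a + ζ • x)) +
      Complex.wedgeIntegral w z (fun ζ => F (a + ζ • x)) = 0 := by
  obtain ⟨M₀, hM₀⟩ := hbd x
  set M := max M₀ 1
  have hMpos : 0 < M := zero_lt_one.trans_le (le_max_right _ _)
  have hM : ∀ y, ‖ev y x‖ ≤ M := fun y => (hM₀ y).trans (le_max_left _ _)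
  have key : ∀ N : ℕ, 1 ≤ N → ‖Complex.wedgeIntegral z w (fun ζ => F (a + ζ • x)) +
      Complex.wedgeIntegral w z (fun ζ => F (a + ζ • x))‖ ≤
        2 * M / N * |w.im - z.im| * |w.re - z.re| := by
    intro N hN
    set G : (Fin (N + 1) → ℂ) → ℂ := fun v => F (a + ∑ i, v i • x ^ (i : ℕ)) with hGdef
    have hG : ∀ u v, ∃ y, G u - G v = ∑ i, (u - v) i * ev y x ^ (i : ℕ) := by
      intro u v
      obtain ⟨y, hy⟩ := hF (a + ∑ i, u i • x ^ (i : ℕ)) (a + ∑ i, v i • x ^ (i : ℕ))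
      refine ⟨y, hy.trans ?_⟩
      rw [add_sub_add_left_eq_sub, ← Finset.sum_sub_distrib, map_sum]
      refine Finset.sum_congr rfl fun i _ => ?_
      rw [← sub_smul, map_smul, map_pow, smul_eq_mul, Pi.sub_apply]
    have hLip : LipschitzWith (∑ i : Fin (N + 1), M ^ (i : ℕ)).toNNReal G := by
      refine LipschitzWith.of_dist_le_mul fun u v => ?_
      obtain ⟨y, hy⟩ := hG u v
      rw [dist_eq_norm, hy, Real.coe_toNNReal _ (Finset.sum_nonneg fun i _ => by positivity), Finset.sum_mul]
      refine (norm_sum_le _ _).trans (Finset.sum_le_sum fun i _ => ?_)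
      rw [norm_mul, norm_pow, mul_comm, dist_eq_norm]
      gcongr
      · exact hM y
      · exact norm_le_pi_norm (u - v) i
    have hdiff : ∀ v, DifferentiableAt ℝ G v → ‖fderiv ℝ G v (Pi.single ⟨1, by omega⟩ 1) +
        Complex.I * fderiv ℝ G v (Complex.I • Pi.single ⟨1, by omega⟩ 1)‖ ≤ 2 * M / N := by
      intro v hv
      refine norm_dbar_le_of_mem_closure hN (S := range fun y => ev y x) hMpos
        (by rintro _ ⟨y, rfl⟩; exact hM y) (fderiv ℝ G v).toLinearMap fun u => ?_
      -- A difference quotient of `G` in the direction `u` is a value of the polynomial `u` at some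
      -- `ev y x`. The derivative is a limit of these.
      have ht := (hv.hasFDerivAt.hasLineDerivAt u).tendsto_slope_zero
      refine mem_closure_of_tendsto ht ?_
      filter_upwards [self_mem_nhdsWithin] with t ht
      obtain ⟨y, hy⟩ := hG (v + t • u) v
      refine ⟨ev y x, ⟨y, rfl⟩, ?_⟩
      have ht0 : (t : ℂ) ≠ 0 := by exact_mod_cast ht
      rw [hy, add_sub_cancel_left, Complex.real_smul, Finset.mul_sum]
      refine Finset.sum_congr rfl fun i _ => ?_
      rw [Pi.smul_apply, Complex.real_smul, Complex.ofReal_inv]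
      field_simp
    have := norm_wedgeIntegral_lipschitz_le hLip (Pi.single ⟨1, by omega⟩ 1) hdiff 0 z w
    have hline : (fun ζ : ℂ => G (0 + ζ • Pi.single ⟨1, by omega⟩ 1)) = fun ζ => F (a + ζ • x) := by
      ext ζ
      simp only [hGdef]
      rw [Finset.sum_eq_single ⟨1, by omega⟩]
      · simp
      · intro i _ hi
        simp [Pi.single_eq_of_ne hi]
      · simp
    rwa [hline] at this
  have hlim : Tendsto (fun N : ℕ => 2 * M / N * |w.im - z.im| * |w.re - z.re|) atTop (𝓝 0) := by
    have := ((tendsto_const_div_atTop_nhds_zero_nat (2 * M)).mul_const |w.im - z.im|).mul_const |w.re - z.re|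
    simpa using this
  exact norm_le_zero_iff.1 (ge_of_tendsto hlim (eventually_atTop.2 ⟨1, key⟩))

/-- The restriction to a complex line is Lipschitz with vanishing rectangle integrals, hence entire
by Morera. Its derivative is bounded by the Lipschitz constant, hence constant by Liouville. -/
lemma exists_affine_of_spectral (hbd : ∀ a, ∃ C, ∀ x, ‖ev x a‖ ≤ C)
    (hF : ∀ a b, ∃ x, F a - F b = ev x (a - b)) (a x : A) :
    ∃ c : ℂ, ∀ ζ : ℂ, F (a + ζ • x) = F a + ζ * c := by
  obtain ⟨M, hM⟩ := hbd x
  set h : ℂ → ℂ := fun ζ => F (a + ζ • x) with hh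
  have hL : LipschitzWith M.toNNReal h := by
    refine LipschitzWith.of_dist_le_mul fun u v => ?_
    obtain ⟨y, hy⟩ := hF (a + u • x) (a + v • x)
    rw [dist_eq_norm, hh]
    dsimp only
    rw [hy, add_sub_add_left_eq_sub, ← sub_smul, map_smul, smul_eq_mul, norm_mul, mul_comm, dist_eq_norm]
    gcongr
    exact (hM y).trans (Real.le_coe_toNNReal M)
  have hcons : Complex.IsConservativeOn h univ := fun z w _ =>
    eq_neg_of_add_eq_zero_left (wedgeIntegral_add_eq_zero_of_spectral hbd hF a x z w)
  have hd : Differentiable ℂ h := differentiableOn_univ.1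
    ((hcons.isExactOn_univ hL.continuous).differentiableOn isOpen_univ)
  have hdd : Differentiable ℂ (deriv h) := hd.deriv
  have hb : Bornology.IsBounded (range (deriv h)) := by
    refine isBounded_iff_forall_norm_le.2 ⟨M.toNNReal, ?_⟩
    rintro _ ⟨z, rfl⟩
    exact norm_deriv_le_of_lipschitz hL
  refine ⟨deriv h 0, fun ζ => ?_⟩
  have hconst : ∀ z, deriv h z = deriv h 0 := fun z => hdd.apply_eq_apply_of_bounded hb z 0
  have hd2 : Differentiable ℂ fun z => h z - z * deriv h 0 := hd.sub (by fun_prop)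
  have := is_const_of_deriv_eq_zero hd2 (fun z => by
    have h1 : HasDerivAt (fun z => h z - z * deriv h 0) (deriv h z - 1 * deriv h 0) z :=
      (hd z).hasDerivAt.sub ((hasDerivAt_id z).mul_const _)
    rw [h1.deriv, hconst z]
    ring) ζ 0
  have h0 : h 0 = F a := by simp [hh]
  rw [h0] at this
  change h ζ = _
  linear_combination this

/-- A function vanishing at `0` whose increments are spectral values is linear. -/
lemma isLinearMap_of_spectral (hbd : ∀ a, ∃ C, ∀ x, ‖ev x a‖ ≤ C)
    (hF : ∀ a b, ∃ x, F a - F b = ev x (a - b)) (h0 : F 0 = 0) : IsLinearMap ℂ F := by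
  choose c hc using exists_affine_of_spectral hbd hF
  -- On parallel lines `F (a + ζ • x) - F (ζ • x)` is a value of `a`, hence bounded in `ζ`, so the
  -- slopes agree. The number `s` below makes different slopes exceed this bound by `1`.
  have hcc : ∀ a x, c a x = c 0 x := by
    intro a x
    obtain ⟨C, hC⟩ := hbd a
    by_contra hne
    have hpos : 0 < ‖c a x - c 0 x‖ := norm_pos_iff.2 (sub_ne_zero.2 hne)
    set s : ℝ := (C + ‖F a‖ + 1) / ‖c a x - c 0 x‖
    obtain ⟨y, hy⟩ := hF (a + (s : ℂ) • x) (0 + (s : ℂ) • x)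
    have h1 : (s : ℂ) * (c a x - c 0 x) = ev y a - F a := by
      rw [hc, hc, h0, add_sub_add_right_eq_sub, sub_zero] at hy
      linear_combination hy
    have hC0 : 0 ≤ C := (norm_nonneg _).trans (hC y)
    have h2 := congrArg norm h1
    rw [norm_mul, Complex.norm_real, Real.norm_of_nonneg (by positivity), div_mul_cancel₀ _ hpos.ne'] at h2
    have := norm_sub_le (ev y a) (F a)
    have := hC y
    linarith
  have hF1 : ∀ x (ζ : ℂ), F (ζ • x) = ζ * c 0 x := fun x ζ => by simpa [h0] using hc 0 x ζ
  have hF2 : ∀ x, F x = c 0 x := fun x => by simpa using hF1 x 1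
  refine ⟨fun a x => ?_, fun ζ x => by rw [hF1, hF2, smul_eq_mul]⟩
  have := hc a x 1
  rwa [one_smul, one_mul, hcc, ← hF2] at this

open Polynomial in
-- Newton's identity `2 e₂ = p₁² - p₂`; the lower coefficients feed the induction.
lemma two_mul_coeff_two_prod (s : Multiset ℂ) :
    (s.map fun a => (1 - C a * X : ℂ[X])).prod.coeff 0 = 1 ∧
    (s.map fun a => (1 - C a * X : ℂ[X])).prod.coeff 1 = -s.sum ∧
    2 * (s.map fun a => (1 - C a * X : ℂ[X])).prod.coeff 2 = s.sum ^ 2 - (s.map (· ^ 2)).sum := by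
  induction s using Multiset.induction_on with
  | empty => simp [coeff_one]
  | cons a s ih =>
    obtain ⟨h0, h1, h2⟩ := ih
    simp only [Multiset.map_cons, Multiset.prod_cons, Multiset.sum_cons, sub_mul, one_mul, mul_assoc, coeff_sub,
      coeff_C_mul]
    rw [coeff_X_mul_zero, coeff_X_mul (n := 0), coeff_X_mul (n := 1), h0, h1]
    refine ⟨by ring, by ring, ?_⟩
    linear_combination h2

open Polynomial in
-- The elements of `s` are the reciprocals of the roots. The condition `P(0) = 1` makes the roots
-- nonzero and removes the leading constant.
lemma exists_eq_prod_one_sub {P : ℂ[X]} (h0 : P.coeff 0 = 1) :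
    ∃ s : Multiset ℂ, s.card ≤ P.natDegree ∧ (∀ a ∈ s, a ≠ 0 ∧ P.eval a⁻¹ = 0) ∧
      P = (s.map fun a => (1 - C a * X : ℂ[X])).prod := by
  have hP : P ≠ 0 := by rintro rfl; simp at h0
  have hroot : ∀ r ∈ P.roots, r ≠ 0 := by
    rintro r hr rfl
    rw [mem_roots hP, IsRoot.def, ← coeff_zero_eq_eval_zero, h0] at hr
    exact one_ne_zero hr
  refine ⟨P.roots.map (·⁻¹), by simpa using card_roots' P, ?_, ?_⟩
  · intro a ha
    obtain ⟨r, hr, rfl⟩ := Multiset.mem_map.1 ha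
    exact ⟨inv_ne_zero (hroot r hr), by simpa using (mem_roots hP).1 hr⟩
  · have h1 := (IsAlgClosed.splits P).eq_prod_roots
    have h2 : P.roots.map (fun r => X - C r) = P.roots.map (fun r => C (-r) * (1 - C r⁻¹ * X)) := by
      refine Multiset.map_congr rfl fun r hr => ?_
      rw [mul_sub, ← mul_assoc, ← C_mul, neg_mul, mul_inv_cancel₀ (hroot r hr)]
      simp only [map_neg, map_one, neg_mul, one_mul]
      ring
    rw [h2, Multiset.prod_map_mul] at h1
    rw [Multiset.map_map]
    set Q := (P.roots.map ((fun a => (1 - C a * X : ℂ[X])) ∘ (·⁻¹))).prod with hQ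
    have hQ0 : Q.coeff 0 = 1 := by
      rw [hQ, ← Multiset.map_map]
      exact (two_mul_coeff_two_prod _).1
    have h3 : (P.roots.map fun r => C (-r)).prod = C (P.roots.map fun r => -r).prod := by
      rw [map_multiset_prod, Multiset.map_map]; rfl
    have h4 : P = C (P.leadingCoeff * (P.roots.map fun r => -r).prod) * Q := by
      rw [C_mul, ← h3, mul_assoc]; exact h1
    have h5 := congrArg (fun R => R.coeff 0) h4
    simp only [coeff_C_mul, hQ0, h0, mul_one] at h5
    rw [← h5, C_1, one_mul] at h4
    exact h4

/-- A linear functional whose value at each element is a spectral value preserves squares. -/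
lemma map_sq_of_spectral (hbd : ∀ a, ∃ C, ∀ x, ‖ev x a‖ ≤ C) (F : A →ₗ[ℂ] ℂ)
    (hF : ∀ a, ∃ x, F a = ev x a) (x : A) : F (x ^ 2) = F x ^ 2 := by
  obtain ⟨M, hM⟩ := hbd x
  have key : ∀ N : ℕ, 1 ≤ N → ‖F (x ^ 2) - F x ^ 2‖ ≤ (M ^ 2 + ‖F (x ^ 2)‖) / N := by
    intro N hN
    -- `P(t) = F((1 - t x)^N)`, by the binomial theorem and linearity.
    let P : Polynomial ℂ := ∑ i ∈ Finset.range (N + 1),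
      Polynomial.monomial i ((-1) ^ i * N.choose i * F (x ^ i))
    have hcoeff : ∀ i, P.coeff i = (-1) ^ i * N.choose i * F (x ^ i) := by
      intro i
      simp only [P, Polynomial.finsetSum_coeff, Polynomial.coeff_monomial, Finset.sum_ite_eq',
        Finset.mem_range]
      split_ifs with h
      · rfl
      · rw [Nat.choose_eq_zero_of_lt (by omega)]
        simp
    have heval : ∀ t, P.eval t = F ((1 - t • x) ^ N) := by
      intro t
      have h1 : (1 - t • x) ^ N = ∑ i ∈ Finset.range (N + 1), ((-t) ^ i * N.choose i) • x ^ i := by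
        rw [show 1 - t • x = (-t) • x + 1 by rw [neg_smul]; ring, add_pow]
        refine Finset.sum_congr rfl fun i _ => ?_
        rw [smul_pow, one_pow, mul_one, mul_smul, ← nsmul_eq_mul', ← Nat.cast_smul_eq_nsmul ℂ,
          smul_comm]
      rw [h1, map_sum, Polynomial.eval_finsetSum]
      refine Finset.sum_congr rfl fun i _ => ?_
      rw [map_smul, Polynomial.eval_monomial, smul_eq_mul, neg_pow]
      ring
    have hF1 : F 1 = 1 := by
      obtain ⟨y, hy⟩ := hF 1
      rw [hy, map_one]
    obtain ⟨s, hs, hroot, hprod⟩ := exists_eq_prod_one_sub (P := P) (by rw [hcoeff]; simp [hF1])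
    have hdeg : s.card ≤ N := hs.trans (Polynomial.natDegree_le_iff_coeff_eq_zero.2 fun i hi => by
      rw [hcoeff, Nat.choose_eq_zero_of_lt hi]; simp)
    -- At a root `a⁻¹` of `P`, the element `(1 - a⁻¹ x)^N` has the spectral value `0`, so `a` is a
    -- value of `x`.
    have hsM : ∀ a ∈ s, ‖a‖ ≤ M := by
      intro a ha
      obtain ⟨ha0, hae⟩ := hroot a ha
      rw [heval] at hae
      obtain ⟨y, hy⟩ := hF ((1 - a⁻¹ • x) ^ N)
      rw [hae, map_pow, map_sub, map_one, map_smul, smul_eq_mul] at hy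
      have h2 : a = ev y x := by
        have := pow_eq_zero_iff (by omega) |>.1 hy.symm
        field_simp at this
        linear_combination this
      rw [h2]
      exact hM y
    obtain ⟨-, h1, h2⟩ := two_mul_coeff_two_prod s
    rw [← hprod, hcoeff] at h1 h2
    have hM0 : ‖(s.map (· ^ 2)).sum‖ ≤ N * M ^ 2 := by
      rcases s.empty_or_exists_mem with rfl | ⟨b, hb⟩
      · simp; positivity
      have hM0 : 0 ≤ M := (norm_nonneg b).trans (hsM b hb)
      have h3 : ‖(s.map (· ^ 2)).sum‖ ≤ ((s.map (· ^ 2)).map fun z => ‖z‖).sum :=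
        Multiset.le_sum_of_subadditive _ norm_zero.le norm_add_le _
      refine h3.trans ?_
      rw [Multiset.map_map]
      have h4 := Multiset.sum_le_card_nsmul (s.map ((fun z => ‖z‖) ∘ (· ^ 2))) (M ^ 2) (by
        intro r hr
        obtain ⟨a, ha, rfl⟩ := Multiset.mem_map.1 hr
        simp only [Function.comp, norm_pow]
        gcongr
        exact hsM a ha)
      refine h4.trans ?_
      rw [Multiset.card_map, nsmul_eq_mul]
      gcongr
    have hch : (2 : ℂ) * N.choose 2 = N * (N - 1) := by
      rw [Nat.cast_choose_two]
      ring
    have hs1 : s.sum = N * F x := by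
      have := h1
      simp only [pow_one, Nat.choose_one_right] at this
      linear_combination this
    have hNpos : (0 : ℝ) < N := by exact_mod_cast hN
    -- The coefficients give `∑ a = N F(x)` and `N (N - 1) F(x²) = (∑ a)² - ∑ a²`. The error `∑ a²`
    -- is only of order `N`.
    have hmain : (N : ℂ) ^ 2 * (F (x ^ 2) - F x ^ 2) = N * F (x ^ 2) - (s.map (· ^ 2)).sum := by
      rw [hs1] at h2
      linear_combination h2 - F (x ^ 2) * hch
    have h5 := congrArg norm hmain
    rw [norm_mul, norm_pow, Complex.norm_natCast] at h5
    have h6 := norm_sub_le (N * F (x ^ 2)) (s.map (· ^ 2)).sum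
    rw [norm_mul, Complex.norm_natCast] at h6
    rw [le_div_iff₀ hNpos]
    refine le_of_mul_le_mul_left ?_ hNpos
    calc (N : ℝ) * (‖F (x ^ 2) - F x ^ 2‖ * N) = N ^ 2 * ‖F (x ^ 2) - F x ^ 2‖ := by ring
      _ ≤ N * ‖F (x ^ 2)‖ + N * M ^ 2 := by rw [h5]; linarith
      _ = N * (M ^ 2 + ‖F (x ^ 2)‖) := by ring
  have hlim := tendsto_const_div_atTop_nhds_zero_nat (M ^ 2 + ‖F (x ^ 2)‖)
  exact sub_eq_zero.1 (norm_le_zero_iff.1 (ge_of_tendsto hlim (eventually_atTop.2 ⟨1, key⟩)))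

/-- A Kowalski–Słodkowski theorem: a function vanishing at `0` whose increments `F a - F b` are values of `a - b` is an
algebra homomorphism. -/
theorem exists_algHom_of_spectral (hbd : ∀ a, ∃ C, ∀ x, ‖ev x a‖ ≤ C)
    (hF : ∀ a b, ∃ x, F a - F b = ev x (a - b)) (h0 : F 0 = 0) : ∃ χ : A →ₐ[ℂ] ℂ, ∀ a, F a = χ a := by
  let L : A →ₗ[ℂ] ℂ := (isLinearMap_of_spectral hbd hF h0).mk' F
  have hL : ∀ a, ∃ x, L a = ev x a := fun a => by
    obtain ⟨y, hy⟩ := hF a 0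
    rw [h0, sub_zero, sub_zero] at hy
    exact ⟨y, hy⟩
  have h1 : L 1 = 1 := by
    obtain ⟨y, hy⟩ := hL 1
    rw [hy, map_one]
  refine ⟨AlgHom.ofLinearMap L h1 fun x y => ?_, fun a => rfl⟩
  have hsq := map_sq_of_spectral hbd L hL
  -- Polarization: squares determine products in a commutative algebra.
  have h2 := hsq (x + y)
  rw [show (x + y) ^ 2 = x ^ 2 + y ^ 2 + (2 : ℂ) • (x * y) by rw [two_smul]; ring, map_add, map_add, map_smul,
    hsq, hsq, map_add, smul_eq_mul] at h2
  linear_combination h2 / 2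

end KowalskiSlodkowski

/-! ### Characters of the algebra of vector-valued polynomials. -/

lemma VecPoly.toHardy_apply {n m : ℕ} (p : ℝ≥0∞) (P : VecPoly n m) {z : Fin n → ℂ} (hz : z ∈ polydisc n) :
    (P.toHardy p) z = P.eval z := indicator_of_mem hz _

/-- The character `P ↦ P_j(z)` of the algebra of `ℂᵐ`-valued polynomials. -/
noncomputable def VecPoly.evalHom {n m : ℕ} (x : polydisc n × Fin m) : VecPoly n m →ₐ[ℂ] ℂ :=
  (MvPolynomial.aeval x.1.1).comp (Pi.evalAlgHom ℂ (fun _ : Fin m => MvPolynomial (Fin n) ℂ) x.2)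

lemma VecPoly.evalHom_apply {n m : ℕ} (x : polydisc n × Fin m) (P : VecPoly n m) :
    VecPoly.evalHom x P = P.eval x.1.1 x.2 := by
  simp [evalHom, VecPoly.eval, MvPolynomial.aeval_eq_eval]

lemma VecPoly.exists_norm_eval_le {n m : ℕ} (P : VecPoly n m) : ∃ C, ∀ z ∈ polydisc n, ‖P.eval z‖ ≤ C := by
  obtain ⟨C, hC⟩ := (isCompact_closedBall (0 : Fin n → ℂ) 1).exists_bound_of_continuousOn
    P.differentiable_eval.continuous.continuousOn
  refine ⟨C, fun z hz => hC z ?_⟩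
  rw [mem_closedBall_zero_iff, pi_norm_le_iff_of_nonneg zero_le_one]
  exact fun i => (hz i).le

/-- A character of the algebra of `ℂᵐ`-valued polynomials which is dominated by the values in the polydisc is the
evaluation of one coordinate at a point of the polydisc. -/
lemma VecPoly.exists_eq_eval_of_algHom {n m : ℕ} (χ : VecPoly n m →ₐ[ℂ] ℂ)
    (hχ : ∀ P, ∃ x, χ P = VecPoly.evalHom x P) :
    ∃ w ∈ polydisc n, ∃ k : Fin m, ∀ P : VecPoly n m, χ P = P.eval w k := by
  have h1 : ∑ k : Fin m, χ (Pi.single k 1) = 1 := by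
    rw [← map_sum]
    exact (congrArg χ (Finset.univ_sum_single (1 : VecPoly n m))).trans (map_one χ)
  obtain ⟨k, hk⟩ : ∃ k : Fin m, χ (Pi.single k 1) ≠ 0 := by
    by_contra! h
    simp [h] at h1
  -- The coordinate idempotents sum to `1`. A nonzero value of a character at an idempotent is `1`,
  -- and then `χ` sees the coordinate `k` only.
  have hk1 : χ (Pi.single k 1) = 1 := by
    have h2 : χ (Pi.single k 1) * χ (Pi.single k 1) = χ (Pi.single k 1) := by
      rw [← map_mul, ← Pi.single_mul, one_mul]
    exact mul_right_cancel₀ hk (h2.trans (one_mul _).symm)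
  have hcoord : ∀ P : VecPoly n m, χ P = χ (Pi.single k (P k)) := by
    intro P
    have h3 : P * Pi.single k 1 = Pi.single k (P k) := by
      ext1 j
      rcases eq_or_ne j k with rfl | hj
      · simp
      · simp [Pi.single_eq_of_ne hj]
    rw [← h3, map_mul, hk1, mul_one]
  let ψ : MvPolynomial (Fin n) ℂ →ₐ[ℂ] ℂ := χ.comp (Pi.constAlgHom ℂ (Fin m) (MvPolynomial (Fin n) ℂ))
  have hψ : ∀ P : VecPoly n m, χ P = ψ (P k) := by
    intro P
    rw [hcoord P, show ψ (P k) = χ (fun _ => P k) from rfl, hcoord (fun _ => P k)]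
  refine ⟨fun i => ψ (MvPolynomial.X i), fun i => ?_, k, fun P => ?_⟩
  -- The value of `χ` at the tuple with all entries `X i` is a value of `X i` in the open polydisc,
  -- hence of modulus less than `1`.
  · obtain ⟨x, hx⟩ := hχ (fun _ => MvPolynomial.X i)
    change ‖χ (fun _ => MvPolynomial.X i)‖ < 1
    rw [hx, evalHom_apply]
    simpa [VecPoly.eval] using x.1.2 i
  · rw [hψ]
    have : ψ = MvPolynomial.aeval fun i => ψ (MvPolynomial.X i) := by
      ext i; simp
    rw [this, MvPolynomial.aeval_eq_eval]
    simp [VecPoly.eval]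

/-- A zero of the coordinate `j` at `z` means that the increment of `F` is the value of `P - Q`
under the character `(z, j)`. Polynomials are bounded on the polydisc, so the abstract theorem
applies. -/
lemma VecPoly.exists_eq_eval_of_spectral {n m : ℕ} {F : VecPoly n m → ℂ} (h0 : F 0 = 0)
    (hF : ∀ P Q : VecPoly n m, ∃ z ∈ polydisc n, ∃ j : Fin m,
      VecPoly.eval ((F P - F Q) • (1 : VecPoly n m) - (P - Q)) z j = 0) :
    ∃ w ∈ polydisc n, ∃ k : Fin m, ∀ P : VecPoly n m, F P = P.eval w k := by
  have hs : ∀ P Q, ∃ x, F P - F Q = VecPoly.evalHom x (P - Q) := by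
    intro P Q
    obtain ⟨z, hz, j, h⟩ := hF P Q
    refine ⟨(⟨z, hz⟩, j), ?_⟩
    rw [← VecPoly.evalHom_apply (⟨z, hz⟩, j), map_sub, map_smul, map_one, smul_eq_mul, mul_one] at h
    exact sub_eq_zero.1 h
  obtain ⟨χ, hχ⟩ := exists_algHom_of_spectral (ev := VecPoly.evalHom) (fun P => by
    obtain ⟨C, hC⟩ := P.exists_norm_eval_le
    refine ⟨C, fun x => ?_⟩
    rw [VecPoly.evalHom_apply]
    exact (PiLp.norm_apply_le _ _).trans (hC _ x.1.2)) hs h0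
  obtain ⟨w, hw, k, hk⟩ := VecPoly.exists_eq_eval_of_algHom χ fun P => by
    obtain ⟨x, hx⟩ := hs P 0
    rw [h0, sub_zero, sub_zero, hχ] at hx
    exact ⟨x, hx⟩
  exact ⟨w, hw, k, fun P => (hχ P).trans (hk P)⟩

/-! ### Parseval and powers of norms of holomorphic functions on circles. -/

lemma integrable_of_continuous_addCircle {E : Type*} [NormedAddCommGroup E] {v : UnitAddCircle → E}
    (hv : Continuous v) : Integrable v AddCircle.haarAddCircle := by
  exact (hv.integrable_of_hasCompactSupport (HasCompactSupport.of_compactSpace v))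

lemma HasSum.of_eq_fun {ι α : Type*} [AddCommMonoid α] [TopologicalSpace α] {f g : ι → α} {a : α} (h : ∀ k, f k = g k) (hf : HasSum f a) :
    HasSum g a := by
  rwa [← funext h]

/-- Parseval's identity for an absolutely convergent power series on the unit circle. -/
lemma hasSum_sq_norm_of_powerSeries {b : ℕ → ℂ} (hb : Summable fun k => ‖b k‖) {G : UnitAddCircle → ℂ}
    (hG : ∀ t, HasSum (fun k => b k * (AddCircle.toCircle t : ℂ) ^ k) (G t)) :
    HasSum (fun k => ‖b k‖ ^ 2) (∫ t, ‖G t‖ ^ 2 ∂AddCircle.haarAddCircle) := by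
  have hs : Summable fun k : ℕ => b k • (fourier (k : ℤ) : C(UnitAddCircle, ℂ)) :=
    Summable.of_norm (by simpa [norm_smul, fourier_norm] using hb)
  obtain ⟨g, hg⟩ := hs
  have hgG : ∀ t, g t = G t := by
    intro t
    refine HasSum.unique (f := fun k => b k * (AddCircle.toCircle t : ℂ) ^ k) ?_ (hG t)
    have := hg.mapL (ContinuousMap.evalCLM ℂ t)
    simpa [ContinuousMap.evalCLM_apply, fourier_apply, AddCircle.toCircle_nsmul] using this
  let T := ContinuousMap.toLp (E := ℂ) 2 (AddCircle.haarAddCircle (T := 1)) ℂ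
  have hT := hg.mapL T
  have hTk : ∀ k : ℤ, T (fourier k) = fourierLp 2 k := fun k => rfl
  simp only [map_smul, hTk] at hT
  have hcoef : ∀ j : ℤ, HasSum (fun k : ℕ => if (k : ℤ) = j then b k else 0) (fourierCoeff (T g) j) := by
    intro j
    rw [← fourierBasis_repr, HilbertBasis.repr_apply_apply, coe_fourierBasis]
    have h1 := hT.mapL (innerSL ℂ (fourierLp 2 j))
    refine HasSum.of_eq_fun (fun k => ?_) h1
    rw [innerSL_apply_apply, inner_smul_right, orthonormal_iff_ite.1 orthonormal_fourier j k]
    simp [eq_comm]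
  have hnat : ∀ k : ℕ, fourierCoeff (T g) k = b k := by
    intro k
    refine (hcoef k).unique ?_
    convert hasSum_ite_eq k (b k) using 2 with i
    split_ifs <;> simp_all
  have hneg : ∀ j ∉ range ((↑) : ℕ → ℤ), ‖fourierCoeff (T g) j‖ ^ 2 = 0 := by
    intro j hj
    have : fourierCoeff (T g) j = 0 := by
      refine (hcoef j).unique ?_
      convert hasSum_zero using 2 with i
      rw [if_neg fun h => hj ⟨i, h⟩]
    simp [this]
  have hP := hasSum_sq_fourierCoeff (T g)
  rw [← Function.Injective.hasSum_iff Nat.cast_injective hneg] at hP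
  have hint : ∫ t, ‖T g t‖ ^ 2 ∂AddCircle.haarAddCircle = ∫ t, ‖G t‖ ^ 2 ∂AddCircle.haarAddCircle := by
    refine integral_congr_ae ?_
    filter_upwards [ContinuousMap.coeFn_toLp (p := 2) (𝕜 := ℂ) AddCircle.haarAddCircle g] with t ht
    rw [show T g t = g t from ht, hgG]
  rw [hint] at hP
  exact HasSum.of_eq_fun (fun k => by simp [hnat]) hP

/-- The dilation of an entire function is firmly nonexpansive in `L²` of the unit circle. -/
lemma integral_sq_norm_sub_dilation_le {F : ℂ → ℂ} (hF : Differentiable ℂ F) {ρ : ℝ} (h0 : 0 ≤ ρ) (h1 : ρ ≤ 1) :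
    ∫ t : UnitAddCircle, ‖F (AddCircle.toCircle t) - F (ρ * AddCircle.toCircle t)‖ ^ 2 ∂AddCircle.haarAddCircle
      ≤ (∫ t : UnitAddCircle, ‖F (AddCircle.toCircle t)‖ ^ 2 ∂AddCircle.haarAddCircle) -
        ∫ t : UnitAddCircle, ‖F (ρ * AddCircle.toCircle t)‖ ^ 2 ∂AddCircle.haarAddCircle := by
  set a : ℕ → ℂ := fun k => (k.factorial : ℂ)⁻¹ * iteratedDeriv k F 0
  have ha : ∀ z, HasSum (fun k => a k * z ^ k) (F z) := by
    intro z
    refine HasSum.of_eq_fun (fun k => ?_) (Complex.hasSum_taylorSeries_of_entire hF 0 z)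
    simp only [a, sub_zero, smul_eq_mul]
    ring
  have hsum : Summable fun k => ‖a k‖ := by
    simpa using (ha 1).summable.norm
  have hρ : ∀ k, ρ ^ k ≤ 1 := fun k => pow_le_one₀ h0 h1
  have hρ0 : ∀ k, 0 ≤ ρ ^ k := fun k => pow_nonneg h0 k
  have hb : ∀ k, ‖a k * (ρ : ℂ) ^ k‖ = ‖a k‖ * ρ ^ k := by
    intro k
    rw [norm_mul, norm_pow, Complex.norm_real, Real.norm_of_nonneg h0]
  have hc : ∀ k, ‖a k * (1 - (ρ : ℂ) ^ k)‖ = ‖a k‖ * (1 - ρ ^ k) := by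
    intro k
    rw [norm_mul, ← Complex.ofReal_pow, ← Complex.ofReal_one, ← Complex.ofReal_sub, Complex.norm_real,
      Real.norm_of_nonneg (by linarith [hρ k])]
  have P1 := hasSum_sq_norm_of_powerSeries hsum fun t => ha (AddCircle.toCircle t)
  have hρF : ∀ t : UnitAddCircle, HasSum (fun k => a k * (ρ : ℂ) ^ k * (AddCircle.toCircle t : ℂ) ^ k)
      (F (ρ * AddCircle.toCircle t)) := fun t =>
    HasSum.of_eq_fun (fun k => by ring) (ha (ρ * AddCircle.toCircle t))
  have P2 := hasSum_sq_norm_of_powerSeries (b := fun k => a k * (ρ : ℂ) ^ k)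
    (Summable.of_nonneg_of_le (fun _ => norm_nonneg _)
      (fun k => by rw [hb]; exact mul_le_of_le_one_right (norm_nonneg _) (hρ k)) hsum) hρF
  have P3 := hasSum_sq_norm_of_powerSeries (b := fun k => a k * (1 - (ρ : ℂ) ^ k))
    (Summable.of_nonneg_of_le (fun _ => norm_nonneg _)
      (fun k => by rw [hc]; exact mul_le_of_le_one_right (norm_nonneg _) (by linarith [hρ0 k])) hsum)
    fun t => HasSum.of_eq_fun (fun k => by ring) ((ha (AddCircle.toCircle t)).sub (hρF t))
  -- Coefficientwise this is `(1 - ρ^k)² ≤ 1 - ρ^{2k}`, valid since `0 ≤ ρ^k ≤ 1`.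
  refine hasSum_le (fun k => ?_) P3 (P1.sub P2)
  simp only [hb, hc]
  nlinarith [mul_nonneg (sq_nonneg ‖a k‖) (mul_nonneg (hρ0 k) (by linarith [hρ k] : 0 ≤ 1 - ρ ^ k))]

/-- Every continuous real function on the circle is uniformly close to the real part of a polynomial. -/
lemma exists_polynomial_re_near {v : UnitAddCircle → ℝ} (hv : Continuous v) {ε : ℝ} (hε : 0 < ε) :
    ∃ H : Polynomial ℂ, ∀ t, |v t - (H.eval (AddCircle.toCircle t : ℂ)).re| < ε := by
  -- Conjugation turns a negative power into a positive one with the same real part. The free factor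
  -- `c` lets the induction absorb scalars.
  have hspan : ∀ q ∈ Submodule.span ℂ (range (fourier (T := 1))), ∀ c : ℂ,
      ∃ H : Polynomial ℂ, ∀ t, (c * q t).re = (H.eval (AddCircle.toCircle t : ℂ)).re := by
    intro q hq
    induction hq using Submodule.span_induction with
    | mem q hq =>
      obtain ⟨k, rfl⟩ := hq
      intro c
      obtain ⟨d, rfl | rfl⟩ := k.eq_nat_or_neg
      · refine ⟨Polynomial.C c * Polynomial.X ^ d, fun t => ?_⟩
        rw [fourier_apply, natCast_zsmul, AddCircle.toCircle_nsmul, Circle.coe_pow]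
        simp
      · refine ⟨Polynomial.C (starRingEnd ℂ c) * Polynomial.X ^ d, fun t => ?_⟩
        rw [fourier_neg, fourier_apply, natCast_zsmul, AddCircle.toCircle_nsmul, Circle.coe_pow,
          Polynomial.eval_mul, Polynomial.eval_C, Polynomial.eval_pow, Polynomial.eval_X, Complex.mul_re,
          Complex.mul_re, Complex.conj_re, Complex.conj_im, Complex.conj_re, Complex.conj_im]
        ring
    | zero => exact fun c => ⟨0, fun t => by simp⟩
    | add q r _ _ hq hr =>
      intro c
      obtain ⟨H, hH⟩ := hq c
      obtain ⟨K, hK⟩ := hr c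
      refine ⟨H + K, fun t => ?_⟩
      rw [Polynomial.eval_add, Complex.add_re, ← hH, ← hK, ContinuousMap.add_apply, mul_add, Complex.add_re]
    | smul d q _ hq =>
      intro c
      obtain ⟨H, hH⟩ := hq (c * d)
      exact ⟨H, fun t => by rw [← hH, ContinuousMap.smul_apply, smul_eq_mul, mul_assoc]⟩
  let V : C(UnitAddCircle, ℂ) := ⟨fun t => (v t : ℂ), by fun_prop⟩
  have hmem : V ∈ (Submodule.span ℂ (range (fourier (T := 1)))).topologicalClosure := by
    rw [span_fourier_closure_eq_top]; trivial
  obtain ⟨q, hq, hlt⟩ := Metric.mem_closure_iff.1 hmem ε hε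
  obtain ⟨H, hH⟩ := hspan q hq 1
  refine ⟨H, fun t => ?_⟩
  rw [← hH, one_mul]
  have h1 : ‖(V - q) t‖ < ε := (ContinuousMap.norm_coe_le_norm (V - q) t).trans_lt (by rwa [← dist_eq_norm])
  have h2 := Complex.abs_re_le_norm ((V - q) t)
  exact lt_of_le_of_lt (by simpa [V] using h2) h1

lemma continuous_coe_toCircle : Continuous fun t : UnitAddCircle => (AddCircle.toCircle t : ℂ) :=
  continuous_subtype_val.comp AddCircle.continuous_toCircle

/-- For a power `‖g‖ ^ a` of the norm of a holomorphic function, the square of the `L²`-distance between two circles is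
controlled by the growth of the square of the `L²`-norm. -/
lemma integral_sq_sub_norm_rpow_le {E : Type*} [NormedAddCommGroup E] [NormedSpace ℂ E] {g : ℂ → E}
    (hg : DiffContOnCl ℂ g (Metric.ball 0 1)) {a : ℝ} (ha : 0 < a) {ρ : ℝ} (h0 : 0 ≤ ρ) (h1 : ρ ≤ 1) :
    ∫ t : UnitAddCircle, (‖g (AddCircle.toCircle t)‖ ^ a - ‖g (ρ * AddCircle.toCircle t)‖ ^ a) ^ 2
        ∂AddCircle.haarAddCircle ≤
      3 * ((∫ t : UnitAddCircle, (‖g (AddCircle.toCircle t)‖ ^ a) ^ 2 ∂AddCircle.haarAddCircle) -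
        ∫ t : UnitAddCircle, (‖g (ρ * AddCircle.toCircle t)‖ ^ a) ^ 2 ∂AddCircle.haarAddCircle) := by
  have hcl : closure (Metric.ball (0 : ℂ) 1) = Metric.closedBall 0 1 := closure_ball _ one_ne_zero
  have hgc : ContinuousOn g (Metric.closedBall 0 1) := hcl ▸ hg.continuousOn
  have hmem : ∀ {σ : ℝ}, 0 ≤ σ → σ ≤ 1 → ∀ t : UnitAddCircle,
      (σ * AddCircle.toCircle t : ℂ) ∈ Metric.closedBall (0 : ℂ) 1 := by
    intro σ hσ hσ1 t
    rw [mem_closedBall_zero_iff, norm_mul, Circle.norm_coe, Complex.norm_real, Real.norm_of_nonneg hσ, mul_one]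
    exact hσ1
  have hcirc := continuous_coe_toCircle
  have hcont : ∀ {σ : ℝ}, 0 ≤ σ → σ ≤ 1 →
      Continuous fun t : UnitAddCircle => ‖g (σ * AddCircle.toCircle t)‖ ^ a := fun hσ hσ1 =>
    (hgc.comp_continuous (by fun_prop) (hmem hσ hσ1)).norm.rpow_const fun _ => Or.inr ha.le
  set u : UnitAddCircle → ℝ := fun t => ‖g (AddCircle.toCircle t)‖ ^ a with hu
  set w : UnitAddCircle → ℝ := fun t => ‖g (ρ * AddCircle.toCircle t)‖ ^ a with hw
  have huc : Continuous u := by simpa using hcont zero_le_one le_rfl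
  have hwc : Continuous w := hcont h0 h1
  have hu0 : ∀ t, 0 ≤ u t := fun t => by positivity
  have hw0 : ∀ t, 0 ≤ w t := fun t => by positivity
  have key : ∀ η : ℝ, 0 < η → ∫ t, (u t - w t) ^ 2 ∂AddCircle.haarAddCircle ≤
      3 * (2 * (Real.exp η ^ 2 * (∫ t, (u t + η) ^ 2 ∂AddCircle.haarAddCircle)) -
        (∫ t, u t ^ 2 ∂AddCircle.haarAddCircle) - ∫ t, w t ^ 2 ∂AddCircle.haarAddCircle) := by
    intro η hη
    have hpos : ∀ t, 0 < u t + η := fun t => by linarith [hu0 t]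
    -- The shift by `η / 2` equals the accuracy, so `u + η ≤ |exp H| ≤ e^η (u + η)` on the circle.
    -- Adding `η` inside keeps the logarithm finite at zeros of `g`.
    obtain ⟨H, hH⟩ := exists_polynomial_re_near (v := fun t => Real.log (u t + η) + η / 2)
      ((huc.add continuous_const).log (fun t => (hpos t).ne') |>.add continuous_const) (half_pos hη)
    set F : ℂ → ℂ := fun z => Complex.exp (H.eval z) with hF
    have hFd : Differentiable ℂ F := H.differentiable.cexp
    have hFn : ∀ z, ‖F z‖ = Real.exp (H.eval z).re := fun z => Complex.norm_exp _
    have hFlow : ∀ t : UnitAddCircle, u t ≤ ‖F (AddCircle.toCircle t)‖ := by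
      intro t
      have := abs_lt.1 (hH t)
      have h2 : Real.log (u t + η) ≤ (H.eval (AddCircle.toCircle t : ℂ)).re := by linarith
      rw [hFn]
      have := Real.exp_le_exp.2 h2
      rw [Real.exp_log (hpos t)] at this
      linarith
    have hFup : ∀ t : UnitAddCircle, ‖F (AddCircle.toCircle t)‖ ≤ Real.exp η * (u t + η) := by
      intro t
      have := abs_lt.1 (hH t)
      have h2 : (H.eval (AddCircle.toCircle t : ℂ)).re ≤ η + Real.log (u t + η) := by linarith
      rw [hFn]
      have := Real.exp_le_exp.2 h2
      rwa [Real.exp_add, Real.exp_log (hpos t)] at this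
    -- The maximum principle for `exp(-H / a) g`, whose norm to the power `a` is `‖g‖^a / ‖F‖`, at
    -- most `1` on the circle.
    have hmax : ∀ z ∈ Metric.closedBall (0 : ℂ) 1, ‖g z‖ ^ a ≤ ‖F z‖ := by
      intro z hz
      have hexp : Differentiable ℂ fun z => Complex.exp (-(a : ℂ)⁻¹ * H.eval z) :=
        (H.differentiable.const_mul _).cexp
      have hd : DiffContOnCl ℂ (fun z => Complex.exp (-(a : ℂ)⁻¹ * H.eval z) • g z) (Metric.ball 0 1) :=
        hexp.diffContOnCl.smul hg
      have hnorm : ∀ z, ‖Complex.exp (-(a : ℂ)⁻¹ * H.eval z) • g z‖ ^ a = ‖g z‖ ^ a / ‖F z‖ := by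
        intro z
        rw [norm_smul, Complex.norm_exp, hFn, Real.mul_rpow (Real.exp_nonneg _) (norm_nonneg _), ← Real.exp_mul,
          ← Complex.ofReal_inv, ← Complex.ofReal_neg, Complex.re_ofReal_mul,
          show -a⁻¹ * (H.eval z).re * a = -(H.eval z).re by field_simp, Real.exp_neg]
        field_simp
      have hle : ‖Complex.exp (-(a : ℂ)⁻¹ * H.eval z) • g z‖ ≤ 1 := by
        refine Complex.norm_le_of_forall_mem_frontier_norm_le Metric.isBounded_ball hd (fun ζ hζ => ?_)
          (hcl ▸ hz)
        rw [frontier_ball _ one_ne_zero, mem_sphere_zero_iff_norm] at hζ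
        have hζ' : ∃ t : UnitAddCircle, (AddCircle.toCircle t : ℂ) = ζ := by
          obtain ⟨t, ht⟩ := (AddCircle.homeomorphCircle one_ne_zero).surjective
            (⟨ζ, mem_sphere_zero_iff_norm.2 hζ⟩ : Circle)
          refine ⟨t, ?_⟩
          rw [AddCircle.homeomorphCircle_apply] at ht
          rw [ht]
        obtain ⟨t, rfl⟩ := hζ'
        by_contra hlt
        have h3 := Real.one_lt_rpow (not_le.1 hlt) ha
        rw [hnorm, one_lt_div (by rw [hFn]; exact Real.exp_pos _)] at h3
        exact absurd (hFlow t) (not_le.2 h3)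
      have h4 := Real.rpow_le_one (norm_nonneg _) hle ha.le
      rwa [hnorm, div_le_one (by rw [hFn]; exact Real.exp_pos _)] at h4
    have hwF : ∀ t, w t ≤ ‖F (ρ * AddCircle.toCircle t)‖ := fun t => hmax _ (hmem h0 h1 t)
    have hFc : Continuous F := hFd.continuous
    have hF1c : Continuous fun t : UnitAddCircle => F (AddCircle.toCircle t) := hFc.comp hcirc
    have hFρc : Continuous fun t : UnitAddCircle => F (ρ * AddCircle.toCircle t) := hFc.comp (by fun_prop)
    have hpars := integral_sq_norm_sub_dilation_le hFd h0 h1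
    -- Write `u - w = (u - A) + (A - B) + (B - w)` with `A`, `B` the norms of `F` on the two
    -- circles. The outer squares are at most `A² - u²` and `B² - w²`. After Parseval the integral
    -- of `B²` cancels.
    have hstep : ∫ t, (u t - w t) ^ 2 ∂AddCircle.haarAddCircle ≤
        ∫ t : UnitAddCircle, 3 * ((‖F (AddCircle.toCircle t)‖ ^ 2 - u t ^ 2) +
          ‖F (AddCircle.toCircle t) - F (ρ * AddCircle.toCircle t)‖ ^ 2 +
          (‖F (ρ * AddCircle.toCircle t)‖ ^ 2 - w t ^ 2)) ∂AddCircle.haarAddCircle := by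
      refine integral_mono (integrable_of_continuous_addCircle (by fun_prop))
        (integrable_of_continuous_addCircle (by fun_prop)) fun t => ?_
      dsimp only
      have e1 := hFlow t
      have e2 := hwF t
      have e3 := abs_norm_sub_norm_le (F (AddCircle.toCircle t)) (F (ρ * AddCircle.toCircle t))
      have e4 := sq_le_sq' (by linarith [abs_le.1 e3 |>.1]) (abs_le.1 e3).2
      set A := ‖F (AddCircle.toCircle t)‖
      set B := ‖F (ρ * AddCircle.toCircle t)‖
      nlinarith [mul_nonneg (hu0 t) (sub_nonneg.2 e1), mul_nonneg (hw0 t) (sub_nonneg.2 e2),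
        sq_nonneg ((u t - A) - (A - B)), sq_nonneg ((u t - A) - (B - w t)), sq_nonneg ((A - B) - (B - w t))]
    rw [integral_const_mul, integral_add, integral_add, integral_sub, integral_sub] at hstep
    rotate_left
    all_goals try exact integrable_of_continuous_addCircle (by fun_prop)
    have hup : ∫ t : UnitAddCircle, ‖F (AddCircle.toCircle t)‖ ^ 2 ∂AddCircle.haarAddCircle ≤
        Real.exp η ^ 2 * ∫ t, (u t + η) ^ 2 ∂AddCircle.haarAddCircle := by
      rw [← integral_const_mul]
      refine integral_mono (integrable_of_continuous_addCircle (by fun_prop))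
        (integrable_of_continuous_addCircle (by fun_prop)) fun t => ?_
      dsimp only
      rw [← mul_pow]
      exact pow_le_pow_left₀ (norm_nonneg _) (hFup t) 2
    linarith
  have hexpand : ∀ η : ℝ, ∫ t, (u t + η) ^ 2 ∂AddCircle.haarAddCircle =
      (∫ t, u t ^ 2 ∂AddCircle.haarAddCircle) + 2 * η * (∫ t, u t ∂AddCircle.haarAddCircle) + η ^ 2 := by
    intro η
    have : ∀ t, (u t + η) ^ 2 = u t ^ 2 + 2 * η * u t + η ^ 2 := fun t => by ring
    simp only [this]
    rw [integral_add, integral_add, integral_const_mul]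
    · simp
    all_goals exact integrable_of_continuous_addCircle (by fun_prop)
  simp only [hexpand] at key
  have hlim : Tendsto (fun η : ℝ => 3 * (2 * (Real.exp η ^ 2 *
      ((∫ t, u t ^ 2 ∂AddCircle.haarAddCircle) + 2 * η * (∫ t, u t ∂AddCircle.haarAddCircle) + η ^ 2)) -
        (∫ t, u t ^ 2 ∂AddCircle.haarAddCircle) - ∫ t, w t ^ 2 ∂AddCircle.haarAddCircle)) (𝓝[>] 0)
      (𝓝 (3 * (2 * (Real.exp 0 ^ 2 *
      ((∫ t, u t ^ 2 ∂AddCircle.haarAddCircle) + 2 * 0 * (∫ t, u t ∂AddCircle.haarAddCircle) + 0 ^ 2)) -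
        (∫ t, u t ^ 2 ∂AddCircle.haarAddCircle) - ∫ t, w t ^ 2 ∂AddCircle.haarAddCircle))) :=
    (Continuous.tendsto (by fun_prop) _).mono_left nhdsWithin_le_nhds
  have := ge_of_tendsto hlim (eventually_mem_nhdsWithin.mono fun η hη => key η hη)
  rw [Real.exp_zero] at this
  linarith

/-! ### Passage to the torus by slices. -/

lemma integrable_of_continuous_torus {n : ℕ} {E : Type*} [NormedAddCommGroup E] {v : UnitAddTorus (Fin n) → E}
    (hv : Continuous v) : Integrable v (torusMeasure n) :=
  hv.integrable_of_hasCompactSupport (HasCompactSupport.of_compactSpace v)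

/-- Haar measure is invariant under rotating all coordinates by the same angle; average over the
angle and use Fubini. -/
lemma integral_torus_eq_integral_slices {n : ℕ} {v : UnitAddTorus (Fin n) → ℝ} (hv : Continuous v) :
    ∫ x, v x ∂torusMeasure n =
      ∫ x, ∫ t : UnitAddCircle, v ((fun _ => t) + x) ∂AddCircle.haarAddCircle ∂torusMeasure n := by
  have hc : Continuous fun q : UnitAddTorus (Fin n) × UnitAddCircle => v ((fun _ => q.2) + q.1) := by fun_prop
  rw [integral_integral_swap]
  · have : ∀ t : UnitAddCircle, ∫ x, v ((fun _ => t) + x) ∂torusMeasure n = ∫ x, v x ∂torusMeasure n :=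
      fun t => integral_add_left_eq_self v _
    simp [this]
  · exact hc.integrable_of_hasCompactSupport (HasCompactSupport.of_compactSpace _)

lemma toCircle_smul_torusPoint {n : ℕ} (r : ℝ) (x : UnitAddTorus (Fin n)) (t : UnitAddCircle) :
    torusPoint r ((fun _ => t) + x) = (AddCircle.toCircle t : ℂ) • torusPoint r x := by
  ext i
  simp only [torusPoint, Pi.add_apply, AddCircle.toCircle_add, Circle.coe_mul, Pi.smul_apply, smul_eq_mul]
  ring

lemma continuous_comp_torusPoint {n : ℕ} {E : Type*} [NormedAddCommGroup E] [NormedSpace ℂ E]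
    {f : (Fin n → ℂ) → E} (hf : DifferentiableOn ℂ f (polydisc n)) {r : ℝ} (hr : r ∈ Ico (0 : ℝ) 1) :
    Continuous fun x : UnitAddTorus (Fin n) => f (torusPoint r x) :=
  hf.continuousOn.comp_continuous (continuous_torusPoint r) (torusPoint_mem hr)

/-- The disc estimate with ratio `r / s`, applied to the slices `z ↦ f (z • torusPoint s x)` and
integrated over `x`. The left side being nonnegative, it also shows that the means increase with the
radius. -/
lemma integral_torus_sq_sub_norm_rpow_le {n : ℕ} {E : Type*} [NormedAddCommGroup E] [NormedSpace ℂ E]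
    {f : (Fin n → ℂ) → E} (hf : DifferentiableOn ℂ f (polydisc n)) {a : ℝ} (ha : 0 < a) {r s : ℝ} (h0 : 0 ≤ r)
    (hrs : r ≤ s) (hspos : 0 < s) (hs : s < 1) :
    ∫ x, (‖f (torusPoint s x)‖ ^ a - ‖f (torusPoint r x)‖ ^ a) ^ 2 ∂torusMeasure n ≤
      3 * ((∫ x, (‖f (torusPoint s x)‖ ^ a) ^ 2 ∂torusMeasure n) -
        ∫ x, (‖f (torusPoint r x)‖ ^ a) ^ 2 ∂torusMeasure n) := by
  have hcont : ∀ {σ : ℝ}, 0 ≤ σ → σ < 1 →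
      Continuous fun x : UnitAddTorus (Fin n) => ‖f (torusPoint σ x)‖ ^ a := fun hσ hσ1 =>
    (continuous_comp_torusPoint hf ⟨hσ, hσ1⟩).norm.rpow_const fun _ => Or.inr ha.le
  have hsc := hcont hspos.le hs
  have hrc := hcont h0 (hrs.trans_lt hs)
  rw [← integral_sub (integrable_of_continuous_torus (by fun_prop)) (integrable_of_continuous_torus (by fun_prop)),
    ← integral_const_mul, integral_torus_eq_integral_slices (by fun_prop),
    integral_torus_eq_integral_slices
      (v := fun x => 3 * ((‖f (torusPoint s x)‖ ^ a) ^ 2 - (‖f (torusPoint r x)‖ ^ a) ^ 2)) (by fun_prop)]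
  have hint : ∀ v : UnitAddTorus (Fin n) → ℝ, Continuous v →
      Integrable (fun x => ∫ t : UnitAddCircle, v ((fun _ => t) + x) ∂AddCircle.haarAddCircle) (torusMeasure n) := by
    intro v hv
    have hc : Continuous fun q : UnitAddTorus (Fin n) × UnitAddCircle => v ((fun _ => q.2) + q.1) := by fun_prop
    exact (hc.integrable_of_hasCompactSupport (μ := (torusMeasure n).prod AddCircle.haarAddCircle)
      (HasCompactSupport.of_compactSpace _)).integral_prod_left
  refine integral_mono
    (hint (fun x => (‖f (torusPoint s x)‖ ^ a - ‖f (torusPoint r x)‖ ^ a) ^ 2) (by fun_prop))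
    (hint (fun x => 3 * ((‖f (torusPoint s x)‖ ^ a) ^ 2 - (‖f (torusPoint r x)‖ ^ a) ^ 2)) (by fun_prop))
    fun x => ?_
  dsimp only
  set g : ℂ → E := fun z => f (z • torusPoint s x) with hg
  have hgd : DiffContOnCl ℂ g (Metric.ball 0 1) := by
    refine DifferentiableOn.diffContOnCl ?_
    rw [closure_ball _ one_ne_zero]
    refine hf.comp (by fun_prop) fun z hz i => ?_
    rw [Pi.smul_apply, smul_eq_mul, norm_mul]
    have h5 := torusPoint_mem ⟨hspos.le, hs⟩ x i
    have h6 := mem_closedBall_zero_iff.1 hz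
    calc ‖z‖ * ‖torusPoint s x i‖ ≤ 1 * ‖torusPoint s x i‖ := by gcongr
      _ < 1 := by linarith
  have hkey := integral_sq_sub_norm_rpow_le hgd ha (ρ := r / s) (by positivity) ((div_le_one hspos).2 hrs)
  have hs' : ∀ t : UnitAddCircle, f (torusPoint s ((fun _ => t) + x)) = g (AddCircle.toCircle t) := fun t => by
    rw [toCircle_smul_torusPoint]
  have hr' : ∀ t : UnitAddCircle, f (torusPoint r ((fun _ => t) + x)) = g ((r / s : ℝ) * AddCircle.toCircle t) := by
    intro t
    rw [toCircle_smul_torusPoint, hg]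
    dsimp only
    congr 1
    ext i
    simp only [torusPoint, Pi.smul_apply, smul_eq_mul, Complex.ofReal_div]
    have : (s : ℂ) ≠ 0 := by exact_mod_cast hspos.ne'
    field_simp
  simp only [hs', hr']
  rw [integral_const_mul, integral_sub]
  · exact hkey
  · have := (hsc.comp (show Continuous fun t : UnitAddCircle => (fun _ : Fin n => t) + x by fun_prop))
    simp only [Function.comp_def, hs'] at this
    exact integrable_of_continuous_addCircle (this.pow 2)
  · have := (hrc.comp (show Continuous fun t : UnitAddCircle => (fun _ : Fin n => t) + x by fun_prop))
    simp only [Function.comp_def, hr'] at this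
    exact integrable_of_continuous_addCircle (this.pow 2)

/-! ### Elementary inequalities between powers of distances. -/

lemma norm_sub_rpow_le {E : Type*} [NormedAddCommGroup E] {p : ℝ} (hp : 0 < p) (y c : E) :
    ‖y - c‖ ^ p ≤ 2 ^ p * (‖y‖ ^ p + ‖c‖ ^ p) := by
  have h1 : ‖y - c‖ ≤ 2 * max ‖y‖ ‖c‖ := by
    have := norm_sub_le y c
    have := le_max_left ‖y‖ ‖c‖
    have := le_max_right ‖y‖ ‖c‖
    linarith
  have h2 := Real.rpow_le_rpow (norm_nonneg _) h1 hp.le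
  rw [Real.mul_rpow zero_le_two (le_max_of_le_left (norm_nonneg _))] at h2
  refine h2.trans ?_
  gcongr
  rcases max_choice ‖y‖ ‖c‖ with h | h <;> rw [h]
  · linarith [Real.rpow_nonneg (norm_nonneg c) p]
  · linarith [Real.rpow_nonneg (norm_nonneg y) p]

lemma rpow_half_sq {p x : ℝ} (hx : 0 ≤ x) : (x ^ (p / 2)) ^ 2 = x ^ p := by
  rw [← Real.rpow_natCast, ← Real.rpow_mul hx]
  norm_num

/-- On a compact set, the distance of two points is controlled by the differences of their distances to finitely many
centres. -/
lemma exists_finset_norm_sub_rpow_le {E : Type*} [NormedAddCommGroup E] {K : Set (E × E)} (hK : IsCompact K) {p : ℝ} (hp : 0 < p)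
    (hne : ∀ q ∈ K, q.1 ≠ q.2) {a : ℝ} (ha : 0 < a) :
    ∃ (S : Finset E) (C : ℝ), 0 ≤ C ∧ ∀ q ∈ K,
      ‖q.1 - q.2‖ ^ p ≤ C * ∑ c ∈ S, (‖q.1 - c‖ ^ a - ‖q.2 - c‖ ^ a) ^ 2 := by
  classical
  refine hK.induction_on (p := fun K => ∃ (S : Finset E) (C : ℝ), 0 ≤ C ∧ ∀ q ∈ K,
      ‖q.1 - q.2‖ ^ p ≤ C * ∑ c ∈ S, (‖q.1 - c‖ ^ a - ‖q.2 - c‖ ^ a) ^ 2) ⟨∅, 0, le_rfl, by simp⟩ ?_ ?_ ?_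
  · rintro s t hst ⟨S, C, hC, h⟩
    exact ⟨S, C, hC, fun q hq => h q (hst hq)⟩
  · rintro s t ⟨S, C, hC, h⟩ ⟨S', C', hC', h'⟩
    have hsum : ∀ (q : E × E) {T : Finset E}, T ⊆ S ∪ S' → ∑ c ∈ T, (‖q.1 - c‖ ^ a - ‖q.2 - c‖ ^ a) ^ 2 ≤
        ∑ c ∈ S ∪ S', (‖q.1 - c‖ ^ a - ‖q.2 - c‖ ^ a) ^ 2 := fun q T hT =>
      Finset.sum_le_sum_of_subset_of_nonneg hT fun _ _ _ => sq_nonneg _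
    refine ⟨S ∪ S', C + C', by positivity, ?_⟩
    rintro q (hq | hq)
    · refine (h q hq).trans ?_
      have := hsum q Finset.subset_union_left
      gcongr
      linarith
    · refine (h' q hq).trans ?_
      have := hsum q Finset.subset_union_right
      gcongr
      linarith
  · intro q hq
    have hφ : Continuous fun z : E × E => (‖z.1 - q.1‖ ^ a - ‖z.2 - q.1‖ ^ a) ^ 2 := by
      refine (Continuous.sub ?_ ?_).pow 2
      · exact (by fun_prop : Continuous fun z : E × E => ‖z.1 - q.1‖).rpow_const fun _ => Or.inr ha.le
      · exact (by fun_prop : Continuous fun z : E × E => ‖z.2 - q.1‖).rpow_const fun _ => Or.inr ha.le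
    have hψ : Continuous fun z : E × E => ‖z.1 - z.2‖ ^ p :=
      (by fun_prop : Continuous fun z : E × E => ‖z.1 - z.2‖).rpow_const fun _ => Or.inr hp.le
    -- Near a pair `q` of distinct points the single centre `q.1` suffices: its distances to the two
    -- points are `0` and positive.
    set d := (‖q.1 - q.1‖ ^ a - ‖q.2 - q.1‖ ^ a) ^ 2 with hd
    have hdpos : 0 < d := by
      have : 0 < ‖q.2 - q.1‖ ^ a := Real.rpow_pos_of_pos (norm_pos_iff.2 (sub_ne_zero.2 (hne q hq).symm)) a
      rw [hd, sub_self, norm_zero, Real.zero_rpow ha.ne', zero_sub, neg_sq]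
      positivity
    have e1 := hφ.continuousAt.eventually_const_lt (show d / 2 < _ from half_lt_self hdpos)
    have e2 := hψ.continuousAt.eventually_lt_const (show ‖q.1 - q.2‖ ^ p < ‖q.1 - q.2‖ ^ p + 1 from lt_add_one _)
    refine ⟨_, mem_nhdsWithin_of_mem_nhds (e1.and e2), {q.1}, (‖q.1 - q.2‖ ^ p + 1) * (2 / d), by positivity, ?_⟩
    rintro z ⟨h1, h2⟩
    rw [Finset.sum_singleton, mul_assoc]
    have h3 : 1 ≤ 2 / d * (‖z.1 - q.1‖ ^ a - ‖z.2 - q.1‖ ^ a) ^ 2 := by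
      rw [div_mul_eq_mul_div, one_le_div hdpos]
      linarith
    nlinarith [show 0 ≤ ‖q.1 - q.2‖ ^ p + 1 by positivity]

/-- Pairs in the ball with `‖y - y'‖ ^ p ≥ ε` form a compact set off the diagonal; the term `ε` pays
for the other pairs. -/
lemma exists_finset_norm_sub_rpow_le_add {E : Type*} [NormedAddCommGroup E] [ProperSpace E] {p : ℝ}
    (hp : 0 < p) (R : ℝ) {ε : ℝ} (hε : 0 < ε) :
    ∃ (S : Finset E) (C : ℝ), 0 ≤ C ∧ ∀ y y' : E, ‖y‖ ≤ R → ‖y'‖ ≤ R →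
      ‖y - y'‖ ^ p ≤ ε + C * ∑ c ∈ S, (‖y - c‖ ^ (p / 2) - ‖y' - c‖ ^ (p / 2)) ^ 2 := by
  have hψ : Continuous fun z : E × E => ‖z.1 - z.2‖ ^ p :=
    (by fun_prop : Continuous fun z : E × E => ‖z.1 - z.2‖).rpow_const fun _ => Or.inr hp.le
  have hK : IsCompact ((Metric.closedBall (0 : E) R ×ˢ Metric.closedBall (0 : E) R) ∩ {z | ε ≤ ‖z.1 - z.2‖ ^ p}) :=
    ((isCompact_closedBall _ _).prod (isCompact_closedBall _ _)).inter_right (isClosed_le continuous_const hψ)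
  obtain ⟨S, C, hC, h⟩ := exists_finset_norm_sub_rpow_le hK hp (a := p / 2) (by
    rintro ⟨y, y'⟩ ⟨-, hy⟩ heq
    dsimp only at heq
    subst heq
    rw [mem_ofPred_eq, sub_self, norm_zero, Real.zero_rpow hp.ne'] at hy
    exact absurd hε (not_lt.2 hy)) (half_pos hp)
  refine ⟨S, C, hC, fun y y' hy hy' => ?_⟩
  have hnn : 0 ≤ C * ∑ c ∈ S, (‖y - c‖ ^ (p / 2) - ‖y' - c‖ ^ (p / 2)) ^ 2 :=
    mul_nonneg hC (Finset.sum_nonneg fun _ _ => sq_nonneg _)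
  rcases le_total ε (‖y - y'‖ ^ p) with hle | hle
  · have := h (y, y') ⟨⟨mem_closedBall_zero_iff.2 hy, mem_closedBall_zero_iff.2 hy'⟩, hle⟩
    dsimp only at this
    linarith
  · linarith

/-- Since `b` is at most half of `‖y‖ ^ (p / 2)`, the difference retains at least half of that
power. This replaces uniform integrability, with `b` coming from a fixed bounded dilate. -/
lemma norm_sub_rpow_le_of_large {E : Type*} [NormedAddCommGroup E] {p : ℝ} (hp : 0 < p) {R b : ℝ} (hR : 0 ≤ R) (hb : 2 * b ≤ R ^ (p / 2)) {y y' : E}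
    (h : R < ‖y‖) (hle : ‖y'‖ ≤ ‖y‖) : ‖y - y'‖ ^ p ≤ 4 * 2 ^ p * (‖y‖ ^ (p / 2) - b) ^ 2 := by
  have h1 : R ^ (p / 2) ≤ ‖y‖ ^ (p / 2) := Real.rpow_le_rpow hR h.le (half_pos hp).le
  have h2 : ‖y - y'‖ ^ p ≤ (2 * ‖y‖) ^ p :=
    Real.rpow_le_rpow (norm_nonneg _) ((norm_sub_le _ _).trans (by linarith)) hp.le
  rw [Real.mul_rpow zero_le_two (norm_nonneg _), ← rpow_half_sq (norm_nonneg y)] at h2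
  refine h2.trans ?_
  rw [mul_comm 4, mul_assoc]
  gcongr
  have h3 : 0 ≤ ‖y‖ ^ (p / 2) := by positivity
  nlinarith

/-! ### Convergence of dilates in the Hardy (quasi-)norm. -/

section Dilates

variable {n : ℕ} {E : Type*} [NormedAddCommGroup E] [NormedSpace ℂ E]

/-- The means `J` are monotone and bounded, and `3 (J s - J r)` controls the integral. Beyond a
radius where `J` is within `ε / 3` of its supremum, the integral is below `ε`. -/
lemma tendsto_integral_sq_sub_norm_rpow {f : (Fin n → ℂ) → E} (hf : DifferentiableOn ℂ f (polydisc n))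
    {a : ℝ} (ha : 0 < a) {B : ℝ}
    (hB : ∀ r ∈ Ico (0 : ℝ) 1, ∫ x, (‖f (torusPoint r x)‖ ^ a) ^ 2 ∂torusMeasure n ≤ B) :
    Tendsto (fun q : ℝ × ℝ =>
      ∫ x, (‖f (torusPoint q.1 x)‖ ^ a - ‖f (torusPoint q.2 x)‖ ^ a) ^ 2 ∂torusMeasure n)
      (𝓝[<] 1 ×ˢ 𝓝[<] 1) (𝓝 0) := by
  set J : ℝ → ℝ := fun r => ∫ x, (‖f (torusPoint r x)‖ ^ a) ^ 2 ∂torusMeasure n with hJ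
  have hD : ∀ {r s : ℝ}, 0 < r → r ≤ s → s < 1 →
      ∫ x, (‖f (torusPoint s x)‖ ^ a - ‖f (torusPoint r x)‖ ^ a) ^ 2 ∂torusMeasure n ≤ 3 * (J s - J r) :=
    fun hr hrs hs => integral_torus_sq_sub_norm_rpow_le hf ha hr.le hrs (hr.trans_le hrs) hs
  have hmono : ∀ {r s : ℝ}, 0 < r → r ≤ s → s < 1 → J r ≤ J s := by
    intro r s hr hrs hs
    have h1 := hD hr hrs hs
    have h2 : 0 ≤ ∫ x, (‖f (torusPoint s x)‖ ^ a - ‖f (torusPoint r x)‖ ^ a) ^ 2 ∂torusMeasure n :=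
      integral_nonneg fun x => sq_nonneg _
    linarith
  have hne : (J '' Ioo 0 1).Nonempty := ⟨_, mem_image_of_mem J (⟨by norm_num, by norm_num⟩ : (1 / 2 : ℝ) ∈ Ioo 0 1)⟩
  have hbdd : BddAbove (J '' Ioo 0 1) := ⟨B, by rintro _ ⟨r, hr, rfl⟩; exact hB r ⟨hr.1.le, hr.2⟩⟩
  rw [Metric.tendsto_nhds]
  intro ε hε
  obtain ⟨_, ⟨r₀, hr₀, rfl⟩, hlt⟩ := exists_lt_of_lt_csSup hne
    (show sSup (J '' Ioo 0 1) - ε / 3 < sSup (J '' Ioo 0 1) by linarith)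
  have hev : ∀ᶠ r : ℝ in 𝓝[<] 1, r ∈ Ioo r₀ 1 := Ioo_mem_nhdsLT hr₀.2
  filter_upwards [hev.prod_mk hev] with ⟨s, s'⟩ ⟨hs, hs'⟩
  dsimp only at hs hs' ⊢
  rw [dist_zero_right, Real.norm_of_nonneg (integral_nonneg fun x => sq_nonneg _)]
  have main : ∀ {s s' : ℝ}, s ∈ Ioo r₀ 1 → s' ∈ Ioo r₀ 1 → s' ≤ s →
      ∫ x, (‖f (torusPoint s x)‖ ^ a - ‖f (torusPoint s' x)‖ ^ a) ^ 2 ∂torusMeasure n < ε := by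
    intro s s' hs hs' hle
    have hs'0 := hr₀.1.trans hs'.1
    refine (hD hs'0 hle hs.2).trans_lt ?_
    have h1 := hmono hr₀.1 hs'.1.le hs'.2
    have h2 : J s ≤ sSup (J '' Ioo 0 1) := le_csSup hbdd (mem_image_of_mem J ⟨hs'0.trans_le hle, hs.2⟩)
    linarith
  rcases le_total s' s with h | h
  · exact main hs hs' h
  · refine lt_of_eq_of_lt (integral_congr_ae (ae_of_all _ fun x => ?_)) (main hs' hs h)
    dsimp only
    ring

/-- The dilates of a holomorphic function with bounded `p`-means form a Cauchy family in `L^p` of the torus. -/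
lemma tendsto_integral_norm_sub_rpow [ProperSpace E] {f : (Fin n → ℂ) → E}
    (hf : DifferentiableOn ℂ f (polydisc n)) {p : ℝ} (hp : 0 < p) {B : ℝ}
    (hB : ∀ r ∈ Ico (0 : ℝ) 1, ∫ x, ‖f (torusPoint r x)‖ ^ p ∂torusMeasure n ≤ B) :
    Tendsto (fun q : ℝ × ℝ => ∫ x, ‖f (torusPoint q.1 x) - f (torusPoint q.2 x)‖ ^ p ∂torusMeasure n)
      (𝓝[<] 1 ×ˢ 𝓝[<] 1) (𝓝 0) := by
  have ha : 0 < p / 2 := half_pos hp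
  have hfc : ∀ {r : ℝ}, r ∈ Ico (0 : ℝ) 1 → Continuous fun x : UnitAddTorus (Fin n) => f (torusPoint r x) :=
    fun hr => continuous_comp_torusPoint hf hr
  have hcp : ∀ {q : ℝ} {h : UnitAddTorus (Fin n) → E}, 0 < q → Continuous h → Continuous fun x => ‖h x‖ ^ q :=
    fun hq hh => hh.norm.rpow_const fun _ => Or.inr hq.le
  -- The function `f - c` is again holomorphic with bounded means, for every centre `c`.
  have hT : ∀ c : E, Tendsto (fun q : ℝ × ℝ => ∫ x, (‖f (torusPoint q.1 x) - c‖ ^ (p / 2) -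
      ‖f (torusPoint q.2 x) - c‖ ^ (p / 2)) ^ 2 ∂torusMeasure n) (𝓝[<] 1 ×ˢ 𝓝[<] 1) (𝓝 0) := by
    intro c
    refine tendsto_integral_sq_sub_norm_rpow (hf.sub_const c) ha (B := 2 ^ p * (B + ‖c‖ ^ p)) fun r hr => ?_
    have h1 : ∫ x, (‖f (torusPoint r x) - c‖ ^ (p / 2)) ^ 2 ∂torusMeasure n ≤
        ∫ x, 2 ^ p * (‖f (torusPoint r x)‖ ^ p + ‖c‖ ^ p) ∂torusMeasure n := by
      refine integral_mono (integrable_of_continuous_torus ((hcp ha ((hfc hr).sub continuous_const)).pow 2))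
        (integrable_of_continuous_torus (((hcp hp (hfc hr)).add continuous_const).const_mul _)) fun x => ?_
      dsimp only
      rw [rpow_half_sq (norm_nonneg _)]
      exact norm_sub_rpow_le hp _ _
    rw [integral_const_mul, integral_add (integrable_of_continuous_torus (hcp hp (hfc hr))) (integrable_const _)] at h1
    refine h1.trans ?_
    have := hB r hr
    gcongr
    simp
  have hev : ∀ᶠ r : ℝ in 𝓝[<] 1, r ∈ Ico (0 : ℝ) 1 :=
    mem_of_superset (Ioo_mem_nhdsLT zero_lt_one) Ioo_subset_Ico_self
  rw [Metric.tendsto_nhds]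
  intro ε hε
  set D : ℝ := 4 * 2 ^ p with hD
  have hDpos : 0 < D := by positivity
  have hT0 : ∀ᶠ r in 𝓝[<] (1 : ℝ), ∀ᶠ s in 𝓝[<] (1 : ℝ), ∫ x, (‖f (torusPoint s x)‖ ^ (p / 2) -
      ‖f (torusPoint r x)‖ ^ (p / 2)) ^ 2 ∂torusMeasure n < ε / (4 * D) := by
    have := (hT 0).eventually_lt_const (show 0 < ε / (4 * D) by positivity)
    simp only [sub_zero] at this
    exact (eventually_swap_iff.1 this).curry
  -- The dilate at `r₁` is bounded by some `M` and serves as the reference for large values. The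
  -- threshold `R` is chosen with `R ^ (p / 2) = 2 M ^ (p / 2)`.
  obtain ⟨r₁, hr₁, hr₁m⟩ := (hT0.and hev).exists
  obtain ⟨M, hM⟩ : ∃ M, ∀ x, ‖f (torusPoint r₁ x)‖ ≤ M := by
    obtain ⟨M, hM⟩ := isCompact_univ.exists_bound_of_continuousOn (hfc hr₁m).continuousOn
    exact ⟨M, fun x => hM x (mem_univ x)⟩
  have hM0 : 0 ≤ M := (norm_nonneg _).trans (hM 0)
  set R : ℝ := (2 * M ^ (p / 2)) ^ (p / 2)⁻¹ with hR
  have hR0 : 0 ≤ R := by positivity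
  have hRp : R ^ (p / 2) = 2 * M ^ (p / 2) := by
    rw [hR, ← Real.rpow_mul (by positivity), inv_mul_cancel₀ ha.ne', Real.rpow_one]
  have hb : ∀ x, 2 * ‖f (torusPoint r₁ x)‖ ^ (p / 2) ≤ R ^ (p / 2) := by
    intro x
    rw [hRp]
    have := hM x
    gcongr
  obtain ⟨S, C, hC, hS⟩ := exists_finset_norm_sub_rpow_le_add (E := E) hp R (show 0 < ε / 4 by positivity)
  have hTS : ∀ᶠ q : ℝ × ℝ in 𝓝[<] 1 ×ˢ 𝓝[<] 1, C * ∑ c ∈ S, ∫ x, (‖f (torusPoint q.1 x) - c‖ ^ (p / 2) -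
      ‖f (torusPoint q.2 x) - c‖ ^ (p / 2)) ^ 2 ∂torusMeasure n < ε / 4 := by
    refine Tendsto.eventually_lt_const (show 0 < ε / 4 by positivity) ?_
    have := (tendsto_finsetSum S fun c _ => hT c).const_mul C
    simpa using this
  filter_upwards [hTS, hev.prod_mk hev, hr₁.prod_mk hr₁] with ⟨s, s'⟩ hs1 ⟨hs, hs'⟩ ⟨hs2, hs2'⟩
  dsimp only at *
  rw [dist_zero_right, Real.norm_of_nonneg (integral_nonneg fun x => by positivity)]
  -- If both values have norm at most `R`, the finitely many centres control their distance;
  -- otherwise the larger one is compared with the reference dilate. Each of the four terms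
  -- integrates to at most `ε / 4`.
  have hpt : ∀ x, ‖f (torusPoint s x) - f (torusPoint s' x)‖ ^ p ≤
      (ε / 4 + C * ∑ c ∈ S, (‖f (torusPoint s x) - c‖ ^ (p / 2) - ‖f (torusPoint s' x) - c‖ ^ (p / 2)) ^ 2) +
      (D * (‖f (torusPoint s x)‖ ^ (p / 2) - ‖f (torusPoint r₁ x)‖ ^ (p / 2)) ^ 2 +
       D * (‖f (torusPoint s' x)‖ ^ (p / 2) - ‖f (torusPoint r₁ x)‖ ^ (p / 2)) ^ 2) := by
    intro x
    set y := f (torusPoint s x)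
    set y' := f (torusPoint s' x)
    have n1 : 0 ≤ C * ∑ c ∈ S, (‖y - c‖ ^ (p / 2) - ‖y' - c‖ ^ (p / 2)) ^ 2 :=
      mul_nonneg hC (Finset.sum_nonneg fun _ _ => sq_nonneg _)
    have n2 : 0 ≤ D * (‖y‖ ^ (p / 2) - ‖f (torusPoint r₁ x)‖ ^ (p / 2)) ^ 2 := by positivity
    have n3 : 0 ≤ D * (‖y'‖ ^ (p / 2) - ‖f (torusPoint r₁ x)‖ ^ (p / 2)) ^ 2 := by positivity
    by_cases h : ‖y‖ ≤ R ∧ ‖y'‖ ≤ R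
    · have := hS y y' h.1 h.2
      linarith
    · rcases le_total ‖y'‖ ‖y‖ with hle | hle
      · have hlt : R < ‖y‖ := not_le.1 fun h1 => h ⟨h1, hle.trans h1⟩
        have := norm_sub_rpow_le_of_large hp hR0 (hb x) hlt hle
        linarith
      · have hlt : R < ‖y'‖ := not_le.1 fun h1 => h ⟨hle.trans h1, h1⟩
        have := norm_sub_rpow_le_of_large hp hR0 (hb x) hlt hle
        rw [norm_sub_rev] at this
        linarith
  have c1 := fun c : E => hcp ha ((hfc hs).sub (continuous_const (y := c)))
  have c2 := fun c : E => hcp ha ((hfc hs').sub (continuous_const (y := c)))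
  have c3 := hcp ha (hfc hs)
  have c4 := hcp ha (hfc hs')
  have c5 := hcp ha (hfc hr₁m)
  have c6 := hcp hp ((hfc hs).sub (hfc hs'))
  have hI : ∫ x, ‖f (torusPoint s x) - f (torusPoint s' x)‖ ^ p ∂torusMeasure n ≤ _ :=
    integral_mono (integrable_of_continuous_torus c6) (integrable_of_continuous_torus (by fun_prop)) hpt
  rw [integral_add, integral_add, integral_add, integral_const_mul, integral_const_mul, integral_const_mul,
    integral_finsetSum] at hI
  · have hd1 : D * ∫ x, (‖f (torusPoint s x)‖ ^ (p / 2) - ‖f (torusPoint r₁ x)‖ ^ (p / 2)) ^ 2 ∂torusMeasure n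
        ≤ ε / 4 := by
      rw [lt_div_iff₀ (by positivity)] at hs2
      linarith
    have hd2 : D * ∫ x, (‖f (torusPoint s' x)‖ ^ (p / 2) - ‖f (torusPoint r₁ x)‖ ^ (p / 2)) ^ 2 ∂torusMeasure n
        ≤ ε / 4 := by
      rw [lt_div_iff₀ (by positivity)] at hs2'
      linarith
    have hconst : ∫ _x : UnitAddTorus (Fin n), ε / 4 ∂torusMeasure n = ε / 4 := by simp
    rw [hconst] at hI
    linarith
  · exact fun c _ => integrable_of_continuous_torus (((c1 c).sub (c2 c)).pow 2)
  all_goals exact integrable_of_continuous_torus (by fun_prop)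

/-- The dilates of a holomorphic function with bounded `p`-means converge to it in the Hardy norm. -/
lemma eventually_integral_dilate_sub_le [ProperSpace E] {f : (Fin n → ℂ) → E}
    (hf : DifferentiableOn ℂ f (polydisc n)) {p : ℝ} (hp : 0 < p) {B : ℝ}
    (hB : ∀ r ∈ Ico (0 : ℝ) 1, ∫ x, ‖f (torusPoint r x)‖ ^ p ∂torusMeasure n ≤ B) {ε : ℝ} (hε : 0 < ε) :
    ∀ᶠ r : ℝ in 𝓝[<] 1, ∀ ρ ∈ Ico (0 : ℝ) 1,
      ∫ x, ‖f ((r : ℂ) • torusPoint ρ x) - f (torusPoint ρ x)‖ ^ p ∂torusMeasure n ≤ ε := by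
  have hT := (tendsto_integral_norm_sub_rpow hf hp hB).eventually_lt_const hε
  have hbas := (nhdsLT_basis (1 : ℝ)).prod_self
  obtain ⟨s₀, hs₀1, hs₀⟩ := hbas.eventually_iff.1 hT
  set s₁ := max s₀ 0 with hs₁
  have hs₁1 : s₁ < 1 := max_lt hs₀1 zero_lt_one
  have hs₁0 : 0 ≤ s₁ := le_max_right _ _
  -- Two factors above `√s₁` have product above `s₁`, so both `r * ρ'` and `ρ'` lie in the Cauchy
  -- range.
  set r₀ := √s₁ with hr₀
  have hr₀1 : r₀ < 1 := by rw [hr₀, Real.sqrt_lt' one_pos]; simpa using hs₁1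
  have hr₀0 : 0 ≤ r₀ := Real.sqrt_nonneg _
  have hsq : r₀ * r₀ = s₁ := Real.mul_self_sqrt hs₁0
  filter_upwards [Ioo_mem_nhdsLT hr₀1] with r hr ρ hρ
  have hr0 : 0 < r := hr₀0.trans_lt hr.1
  set g : (Fin n → ℂ) → E := fun z => f ((r : ℂ) • z) - f z with hg
  have hgd : DifferentiableOn ℂ g (polydisc n) := by
    refine DifferentiableOn.sub (hf.comp (by fun_prop) fun z hz i => ?_) hf
    rw [Pi.smul_apply, smul_eq_mul, norm_mul, Complex.norm_real, Real.norm_of_nonneg hr0.le]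
    have := hz i
    nlinarith [norm_nonneg (z i), hr.2]
  -- The means of `g` increase with the radius, so `ρ` may be replaced by a larger `ρ'` in the
  -- Cauchy range. This gives uniformity in `ρ`.
  obtain ⟨ρ', hρ'1, hρ'2, hρ'3⟩ : ∃ ρ', ρ' < 1 ∧ r₀ < ρ' ∧ ρ ≤ ρ' := by
    refine ⟨(max r₀ ρ + 1) / 2, ?_, ?_, ?_⟩
    · have := max_lt hr₀1 hρ.2; linarith
    · have := le_max_left r₀ ρ; linarith
    · have := le_max_right r₀ ρ; linarith [hρ.2]
  have hρ'0 : 0 < ρ' := hr₀0.trans_lt hρ'2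
  have h1 := integral_torus_sq_sub_norm_rpow_le hgd (half_pos hp) hρ.1 hρ'3 hρ'0 hρ'1
  have h2 : 0 ≤ ∫ x, (‖g (torusPoint ρ' x)‖ ^ (p / 2) - ‖g (torusPoint ρ x)‖ ^ (p / 2)) ^ 2 ∂torusMeasure n :=
    integral_nonneg fun x => sq_nonneg _
  simp only [rpow_half_sq (norm_nonneg _)] at h1
  have hs₀r : s₀ < r * ρ' := by
    have : r₀ * r₀ < r * ρ' := mul_lt_mul'' hr.1 hρ'2 hr₀0 hr₀0
    rw [hsq] at this
    exact (le_max_left s₀ 0).trans_lt this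
  have hs₀ρ : s₀ < ρ' := hs₀r.trans (mul_lt_of_lt_one_left hρ'0 hr.2)
  have h3 := hs₀ (show (r * ρ', ρ') ∈ Ioo s₀ 1 ×ˢ Ioo s₀ 1 from
    ⟨⟨hs₀r, (mul_lt_of_lt_one_left hρ'0 hr.2).trans hρ'1⟩, hs₀ρ, hρ'1⟩)
  have h4 : ∀ x : UnitAddTorus (Fin n), f (torusPoint (r * ρ') x) - f (torusPoint ρ' x) = g (torusPoint ρ' x) := by
    intro x
    rw [hg]
    dsimp only
    congr 2
    ext i
    simp [torusPoint, mul_assoc]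
  dsimp only at h3
  simp only [h4] at h3
  change ∫ x, ‖g (torusPoint ρ x)‖ ^ p ∂torusMeasure n ≤ ε
  linarith

end Dilates

/-! ### Uniform approximation of dilates by polynomials. -/

/-- Orthogonality of the powers of `ω`: interpolation at the `N`-th roots of unity sends `z^j` to
`z^(j % N)`. -/
lemma sum_rootsOfUnity_interpolation {N : ℕ} {ω : ℂ} (hω : IsPrimitiveRoot ω N) (hN : 0 < N) (j : ℕ) (z : ℂ) :
    ∑ k ∈ Finset.range N, z ^ k * ((N : ℂ)⁻¹ * ∑ l ∈ Finset.range N, (ω ^ l) ^ j * ((ω ^ l)⁻¹) ^ k) = z ^ (j % N) := by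
  have hω0 : ω ≠ 0 := hω.ne_zero hN.ne'
  have hN0 : (N : ℂ) ≠ 0 := by exact_mod_cast hN.ne'
  have hinner : ∀ k ∈ Finset.range N, ∑ l ∈ Finset.range N, (ω ^ l) ^ j * ((ω ^ l)⁻¹) ^ k =
      if k = j % N then (N : ℂ) else 0 := by
    intro k hk
    have h1 : ∀ l, (ω ^ l) ^ j * ((ω ^ l)⁻¹) ^ k = (ω ^ j * (ω ^ k)⁻¹) ^ l := by
      intro l
      rw [mul_pow, inv_pow, inv_pow, ← pow_mul, ← pow_mul, ← pow_mul, ← pow_mul, mul_comm l j, mul_comm l k]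
    simp only [h1]
    have hj : ω ^ j = ω ^ (j % N) := by rw [hω.eq_orderOf, pow_mod_orderOf]
    split_ifs with hkj
    · rw [hj, ← hkj, mul_inv_cancel₀ (pow_ne_zero _ hω0)]
      simp
    · have hne : ω ^ j * (ω ^ k)⁻¹ ≠ 1 := by
        intro h
        rw [← div_eq_mul_inv, div_eq_one_iff_eq (pow_ne_zero _ hω0), hj] at h
        exact hkj (hω.pow_inj (Nat.mod_lt _ hN) (Finset.mem_range.1 hk) h).symm
      have h2 : (ω ^ j * (ω ^ k)⁻¹) ^ N = 1 := by
        rw [mul_pow, inv_pow, ← pow_mul, ← pow_mul, mul_comm j, mul_comm k, pow_mul, pow_mul, hω.pow_eq_one]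
        simp
      rw [geom_sum_eq hne, h2, sub_self, zero_div]
  rw [Finset.sum_eq_single (j % N)]
  · rw [hinner _ (Finset.mem_range.2 (Nat.mod_lt _ hN)), if_pos rfl, inv_mul_cancel₀ hN0, mul_one]
  · intro k hk hkj
    rw [hinner k hk, if_neg hkj]
    simp
  · intro h
    exact absurd (Finset.mem_range.2 (Nat.mod_lt _ hN)) h

/-- Interpolation at roots of unity approximates bounded holomorphic functions on a larger disc uniformly. -/
lemma exists_interpolation_near {R : ℝ} (hR : 1 < R) (C : ℝ) {ε : ℝ} (hε : 0 < ε) :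
    ∃ (N : ℕ) (ω : ℂ), 0 < N ∧ ‖ω‖ = 1 ∧ ∀ h : ℂ → ℂ, DifferentiableOn ℂ h (Metric.ball 0 R) →
      (∀ z ∈ Metric.ball (0 : ℂ) R, ‖h z‖ ≤ C) → ∀ z : ℂ, ‖z‖ ≤ 1 →
      ‖h z - ∑ k ∈ Finset.range N, z ^ k * ((N : ℂ)⁻¹ * ∑ l ∈ Finset.range N, h (ω ^ l) * ((ω ^ l)⁻¹) ^ k)‖ ≤ ε := by
  set ρ : ℝ := (1 + R) / 2 with hρ
  have hρ1 : 1 < ρ := by rw [hρ]; linarith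
  have hρR : ρ < R := by rw [hρ]; linarith
  have hρ0 : 0 < ρ := zero_lt_one.trans hρ1
  -- Cauchy's estimate is `|a_j| ≤ |C| σ^{2j}`. For `j ≥ N` one factor `σ^j` yields `σ^N` and the
  -- other stays summable. The choice of `N` does not depend on `h`.
  set σ : ℝ := √(ρ⁻¹) with hσ
  have hσsq : σ ^ 2 = ρ⁻¹ := Real.sq_sqrt (inv_nonneg.2 hρ0.le)
  have hσ0 : 0 ≤ σ := Real.sqrt_nonneg _
  have hσ1 : σ < 1 := by
    rw [hσ, Real.sqrt_lt' one_pos, one_pow]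
    exact inv_lt_one_of_one_lt₀ hρ1
  have hlim : Tendsto (fun N : ℕ => 2 * |C| * σ ^ N * (1 - σ)⁻¹) atTop (𝓝 0) := by
    have := ((tendsto_pow_atTop_nhds_zero_of_lt_one hσ0 hσ1).const_mul (2 * |C|)).mul_const (1 - σ)⁻¹
    simpa using this
  obtain ⟨N, hNε, hN⟩ := ((hlim.eventually_lt_const hε).and (eventually_gt_atTop 0)).exists
  have hω := Complex.isPrimitiveRoot_exp N hN.ne'
  set ω := Complex.exp (2 * Real.pi * Complex.I / N)
  have hωn : ‖ω‖ = 1 := hω.norm'_eq_one hN.ne'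
  refine ⟨N, ω, hN, hωn, fun h hd hC z hz => ?_⟩
  have hC0 : C ≤ |C| := le_abs_self C
  set a : ℕ → ℂ := fun k => (k.factorial : ℂ)⁻¹ * iteratedDeriv k h 0
  have ha : ∀ z ∈ Metric.ball (0 : ℂ) R, HasSum (fun k => a k * z ^ k) (h z) := by
    intro z hz
    refine HasSum.of_eq_fun (fun k => ?_) (Complex.hasSum_taylorSeries_on_ball hd hz)
    simp only [a, sub_zero, smul_eq_mul]
    ring
  have hab : ∀ k, ‖a k‖ ≤ |C| * σ ^ (2 * k) := by
    intro k
    have h1 := Complex.norm_iteratedDeriv_le_of_forall_mem_sphere_norm_le k hρ0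
      (f := h) (c := 0) (C := |C|) (hd.mono (by
        rw [closure_ball _ hρ0.ne']; exact Metric.closedBall_subset_ball hρR)).diffContOnCl
      (fun z hz => (hC z (Metric.sphere_subset_closedBall.trans (Metric.closedBall_subset_ball hρR) hz)).trans hC0)
    rw [norm_mul, norm_inv, Complex.norm_natCast, pow_mul, hσsq, inv_pow, inv_mul_le_iff₀ (by positivity)]
    refine h1.trans (le_of_eq ?_)
    field_simp
  have hmem : ∀ {z : ℂ}, ‖z‖ ≤ 1 → z ∈ Metric.ball (0 : ℂ) R := fun hz =>
    mem_ball_zero_iff.2 (hz.trans_lt hR)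
  have hI : HasSum (fun j => a j * z ^ (j % N))
      (∑ k ∈ Finset.range N, z ^ k * ((N : ℂ)⁻¹ * ∑ l ∈ Finset.range N, h (ω ^ l) * ((ω ^ l)⁻¹) ^ k)) := by
    have h2 := hasSum_sum (s := Finset.range N) (f := fun k j => z ^ k * ((N : ℂ)⁻¹ *
        ∑ l ∈ Finset.range N, a j * (ω ^ l) ^ j * ((ω ^ l)⁻¹) ^ k)) fun k _ =>
      ((hasSum_sum (s := Finset.range N) fun l _ =>
        (ha (ω ^ l) (hmem (by rw [norm_pow, hωn, one_pow]))).mul_right (((ω ^ l)⁻¹) ^ k)).mul_left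
          ((N : ℂ)⁻¹)).mul_left (z ^ k)
    refine HasSum.of_eq_fun (fun j => ?_) h2
    rw [← sum_rootsOfUnity_interpolation hω hN j z, Finset.mul_sum]
    refine Finset.sum_congr rfl fun k _ => ?_
    simp only [mul_assoc, ← Finset.mul_sum]
    ring
  have hsub := (ha z (hmem hz)).sub hI
  have hgeo : HasSum (fun j : ℕ => 2 * |C| * σ ^ N * σ ^ j) (2 * |C| * σ ^ N * (1 - σ)⁻¹) :=
    (hasSum_geometric_of_lt_one hσ0 hσ1).mul_left _
  have hterm : ∀ j, ‖a j * z ^ j - a j * z ^ (j % N)‖ ≤ 2 * |C| * σ ^ N * σ ^ j := by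
    intro j
    rcases lt_or_ge j N with hj | hj
    · rw [Nat.mod_eq_of_lt hj, sub_self, norm_zero]
      positivity
    · rw [← mul_sub, norm_mul]
      have h3 : ‖z ^ j - z ^ (j % N)‖ ≤ 2 := by
        refine (norm_sub_le _ _).trans ?_
        rw [norm_pow, norm_pow]
        have := pow_le_one₀ (n := j) (norm_nonneg z) hz
        have := pow_le_one₀ (n := j % N) (norm_nonneg z) hz
        linarith
      have h4 : σ ^ (2 * j) ≤ σ ^ N * σ ^ j := by
        rw [two_mul, pow_add]
        have := pow_le_pow_of_le_one hσ0 hσ1.le hj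
        gcongr
      calc ‖a j‖ * ‖z ^ j - z ^ (j % N)‖ ≤ (|C| * (σ ^ N * σ ^ j)) * 2 := by
            have := (hab j).trans (mul_le_mul_of_nonneg_left h4 (abs_nonneg C))
            gcongr
        _ = 2 * |C| * σ ^ N * σ ^ j := by ring
  rw [← hsub.tsum_eq]
  exact (tsum_of_norm_bounded hgeo hterm).trans hNε.le

/-- A bounded holomorphic function on a larger polydisc is uniformly approximable by polynomials on the closed unit
polydisc. -/
lemma exists_mvPolynomial_near {R : ℝ} (hR : 1 < R) (C : ℝ) : ∀ (n : ℕ) (f : (Fin n → ℂ) → ℂ),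
    DifferentiableOn ℂ f {z | ∀ i, ‖z i‖ < R} → (∀ z : Fin n → ℂ, (∀ i, ‖z i‖ < R) → ‖f z‖ ≤ C) →
    ∀ ε : ℝ, 0 < ε → ∃ P : MvPolynomial (Fin n) ℂ, ∀ z : Fin n → ℂ, (∀ i, ‖z i‖ ≤ 1) →
      ‖f z - MvPolynomial.eval z P‖ ≤ ε := by
  intro n
  induction n with
  | zero =>
    intro f _ _ ε hε
    refine ⟨MvPolynomial.C (f 0), fun z _ => ?_⟩
    rw [Subsingleton.elim z 0]
    simpa using hε.le
  | succ n ih =>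
    intro f hf hC ε hε
    obtain ⟨N, ω, hN, hω, hint⟩ := exists_interpolation_near hR C (half_pos hε)
    have hωl : ∀ l : ℕ, ‖ω ^ l‖ = 1 := fun l => by rw [norm_pow, hω, one_pow]
    have hslice : ∀ c : ℂ, ‖c‖ < R → DifferentiableOn ℂ (fun z' : Fin n → ℂ => f (Fin.cons c z'))
        {z | ∀ i, ‖z i‖ < R} := by
      intro c hc
      refine hf.comp ?_ fun z' hz' i => ?_
      · refine Differentiable.differentiableOn (differentiable_pi.2 fun i => ?_)
        refine Fin.cases ?_ (fun j => ?_) i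
        · simp
        · simpa using differentiable_apply j
      · refine Fin.cases ?_ (fun j => ?_) i
        · simpa using hc
        · simpa using hz' j
    -- The factor `1 / N` cancels the sum over nodes, so each of the `N` coefficients has error at
    -- most `ε / (2N)`, in total `ε / 2`.
    have hδ : 0 < ε / (2 * N) := by positivity
    choose Q hQ using fun l : ℕ => ih (fun z' => f (Fin.cons (ω ^ l) z')) (hslice _ (by rw [hωl]; exact hR))
      (fun z' hz' => hC _ fun i => by
        refine Fin.cases ?_ (fun j => ?_) i
        · simpa [hω] using hR
        · simpa using hz' j) (ε / (2 * N)) hδ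
    refine ⟨∑ k ∈ Finset.range N, MvPolynomial.X 0 ^ k * (MvPolynomial.C (N : ℂ)⁻¹ *
      ∑ l ∈ Finset.range N, MvPolynomial.rename Fin.succ (Q l) * MvPolynomial.C (((ω ^ l)⁻¹) ^ k)), fun z hz => ?_⟩
    have h1 := hint (fun c => f (Fin.cons c (Fin.tail z)))
      (hf.comp (Differentiable.differentiableOn (differentiable_pi.2 fun i => by
          refine Fin.cases ?_ (fun j => ?_) i
          · simp
          · simp)) fun c hc i => by
        refine Fin.cases ?_ (fun j => ?_) i
        · simpa using hc
        · simpa [Fin.tail] using (hz j.succ).trans_lt hR)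
      (fun c hc => hC _ fun i => by
        refine Fin.cases ?_ (fun j => ?_) i
        · simpa using hc
        · simpa [Fin.tail] using (hz j.succ).trans_lt hR) (z 0) (hz 0)
    rw [Fin.cons_self_tail] at h1
    set S₁ := ∑ k ∈ Finset.range N, z 0 ^ k * ((N : ℂ)⁻¹ *
      ∑ l ∈ Finset.range N, f (Fin.cons (ω ^ l) (Fin.tail z)) * ((ω ^ l)⁻¹) ^ k) with hS₁
    have h2 : MvPolynomial.eval z (∑ k ∈ Finset.range N, MvPolynomial.X 0 ^ k * (MvPolynomial.C (N : ℂ)⁻¹ *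
      ∑ l ∈ Finset.range N, MvPolynomial.rename Fin.succ (Q l) * MvPolynomial.C (((ω ^ l)⁻¹) ^ k))) =
      ∑ k ∈ Finset.range N, z 0 ^ k * ((N : ℂ)⁻¹ *
      ∑ l ∈ Finset.range N, MvPolynomial.eval (Fin.tail z) (Q l) * ((ω ^ l)⁻¹) ^ k) := by
      simp only [map_sum, map_mul, map_pow, MvPolynomial.eval_X, MvPolynomial.eval_C, MvPolynomial.eval_rename]
      rfl
    have h3 : ‖S₁ - ∑ k ∈ Finset.range N, z 0 ^ k * ((N : ℂ)⁻¹ *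
        ∑ l ∈ Finset.range N, MvPolynomial.eval (Fin.tail z) (Q l) * ((ω ^ l)⁻¹) ^ k)‖ ≤ ε / 2 := by
      rw [hS₁, ← Finset.sum_sub_distrib]
      have hk : ∀ k ∈ Finset.range N, ‖z 0 ^ k * ((N : ℂ)⁻¹ *
          ∑ l ∈ Finset.range N, f (Fin.cons (ω ^ l) (Fin.tail z)) * ((ω ^ l)⁻¹) ^ k) -
          z 0 ^ k * ((N : ℂ)⁻¹ * ∑ l ∈ Finset.range N, MvPolynomial.eval (Fin.tail z) (Q l) * ((ω ^ l)⁻¹) ^ k)‖ ≤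
          ε / (2 * N) := by
        intro k _
        rw [← mul_sub, ← mul_sub, ← Finset.sum_sub_distrib, norm_mul, norm_mul, norm_inv, Complex.norm_natCast]
        have h4 : ‖∑ l ∈ Finset.range N, (f (Fin.cons (ω ^ l) (Fin.tail z)) * ((ω ^ l)⁻¹) ^ k -
            MvPolynomial.eval (Fin.tail z) (Q l) * ((ω ^ l)⁻¹) ^ k)‖ ≤ N * (ε / (2 * N)) := by
          refine (norm_sum_le_of_le _ fun l _ => ?_).trans (le_of_eq (by
            rw [Finset.sum_const, Finset.card_range, nsmul_eq_mul]))
          rw [← sub_mul, norm_mul, norm_pow, norm_inv, hωl, inv_one, one_pow, mul_one]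
          exact hQ l _ fun i => hz i.succ
        have h5 : ‖z 0 ^ k‖ ≤ 1 := by
          rw [norm_pow]
          exact pow_le_one₀ (norm_nonneg _) (hz 0)
        calc _ ≤ 1 * ((N : ℝ)⁻¹ * (N * (ε / (2 * N)))) := by gcongr
          _ = _ := by field_simp
      refine (norm_sum_le_of_le _ hk).trans (le_of_eq ?_)
      rw [Finset.sum_const, Finset.card_range, nsmul_eq_mul]
      field_simp
    rw [h2]
    refine (norm_sub_le_norm_sub_add_norm_sub _ S₁ _).trans ?_
    linarith

lemma EuclideanSpace.norm_le_card_mul {m : ℕ} {y : EuclideanSpace ℂ (Fin m)} {δ : ℝ} (hδ : 0 ≤ δ)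
    (h : ∀ k, ‖y k‖ ≤ δ) : ‖y‖ ≤ (m + 1) * δ := by
  rw [EuclideanSpace.norm_eq, Real.sqrt_le_left (by positivity)]
  calc ∑ i, ‖y i‖ ^ 2 ≤ ∑ _i : Fin m, δ ^ 2 :=
        Finset.sum_le_sum fun i _ => pow_le_pow_left₀ (norm_nonneg _) (h i) 2
    _ = m * δ ^ 2 := by simp
    _ ≤ ((m + 1) * δ) ^ 2 := by
        rw [mul_pow]
        gcongr
        nlinarith [(Nat.cast_nonneg m : (0 : ℝ) ≤ m)]

/-- The dilates of a holomorphic function on the polydisc are uniformly approximable by polynomials. -/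
lemma exists_vecPoly_near_dilate {n m : ℕ} {f : (Fin n → ℂ) → EuclideanSpace ℂ (Fin m)}
    (hf : DifferentiableOn ℂ f (polydisc n)) {r : ℝ} (hr0 : 0 < r) (hr1 : r < 1) {ε : ℝ} (hε : 0 < ε) :
    ∃ P : VecPoly n m, ∀ z ∈ polydisc n, ‖P.eval z - f ((r : ℂ) • z)‖ ≤ ε := by
  -- Multiplication by `r = s²` maps the polydisc of radius `1 / s > 1` into the closed polydisc of
  -- radius `s < 1`, where `f` is bounded.
  set s := √r with hs
  have hs0 : 0 < s := Real.sqrt_pos.2 hr0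
  have hs1 : s < 1 := by rw [hs, Real.sqrt_lt' one_pos]; simpa using hr1
  have hss : s * s = r := Real.mul_self_sqrt hr0.le
  have hrsmul : ∀ {z : Fin n → ℂ}, (∀ i, ‖z i‖ < s⁻¹) → (r : ℂ) • z ∈ Metric.closedBall (0 : Fin n → ℂ) s := by
    intro z hz
    rw [mem_closedBall_zero_iff, pi_norm_le_iff_of_nonneg hs0.le]
    intro i
    rw [Pi.smul_apply, smul_eq_mul, norm_mul, Complex.norm_real, Real.norm_of_nonneg hr0.le]
    calc r * ‖z i‖ ≤ r * s⁻¹ := by gcongr; exact (hz i).le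
      _ = s := by rw [← hss]; field_simp
  have hsub : Metric.closedBall (0 : Fin n → ℂ) s ⊆ polydisc n := by
    intro z hz i
    exact ((norm_le_pi_norm z i).trans (mem_closedBall_zero_iff.1 hz)).trans_lt hs1
  obtain ⟨C, hC⟩ := (isCompact_closedBall (0 : Fin n → ℂ) s).exists_bound_of_continuousOn
    (hf.continuousOn.mono hsub)
  have hk : ∀ k : Fin m, ∃ P : MvPolynomial (Fin n) ℂ, ∀ z : Fin n → ℂ, (∀ i, ‖z i‖ ≤ 1) →
      ‖f ((r : ℂ) • z) k - MvPolynomial.eval z P‖ ≤ ε / (m + 1) := by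
    intro k
    refine exists_mvPolynomial_near (one_lt_inv_iff₀.2 ⟨hs0, hs1⟩) C n (fun z => f ((r : ℂ) • z) k) ?_ ?_ _
      (by positivity)
    · exact (differentiableOn_euclidean.1 hf k).comp (by fun_prop) fun z hz => hsub (hrsmul hz)
    · exact fun z hz => (PiLp.norm_apply_le _ k).trans (hC _ (hrsmul hz))
  choose P hP using hk
  refine ⟨P, fun z hz => ?_⟩
  refine (EuclideanSpace.norm_le_card_mul (δ := ε / (m + 1)) (by positivity) fun k => ?_).trans (le_of_eq ?_)
  · rw [PiLp.sub_apply, norm_sub_rev]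
    exact hP k z fun i => (hz i).le
  · field_simp

/-! ### Density of polynomials for finite `p`. -/

/-- Every open set contains a ball around each of its points. It is not needed that balls are
neighbourhoods. -/
lemma tendsto_hardyNormTopology {p : ℝ≥0∞} {n m : ℕ} {ι : Type*} {l : Filter ι} {F : ι → HardySpace p n m}
    {f : HardySpace p n m} (h : ∀ ε : ℝ≥0∞, 0 < ε → ∀ᶠ j in l, hardyENorm p ⇑(F j - f) < ε) :
    Tendsto F l (@nhds _ (hardyNormTopology p n m) f) := by
  let _ := hardyNormTopology p n m
  refine tendsto_nhds.2 fun U hU hf => ?_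
  obtain ⟨ε, hε, hεU⟩ := hU f hf
  exact (h ε hε).mono fun j hj => hεU _ hj

section Finite

variable {p : ℝ≥0∞} {n m : ℕ}

lemma eLpNorm_torus_eq (hp : p ≠ 0) (hpt : p ≠ ∞) {f : (Fin n → ℂ) → EuclideanSpace ℂ (Fin m)}
    (hf : DifferentiableOn ℂ f (polydisc n)) {r : ℝ} (hr : r ∈ Ico (0 : ℝ) 1) :
    eLpNorm (fun x : UnitAddTorus (Fin n) => f (torusPoint r x)) p (torusMeasure n) =
      ENNReal.ofReal ((∫ x, ‖f (torusPoint r x)‖ ^ p.toReal ∂torusMeasure n) ^ p.toReal⁻¹) := by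
  refine MemLp.eLpNorm_eq_integral_rpow_norm hp hpt ?_
  obtain ⟨C, hC⟩ := isCompact_univ.exists_bound_of_continuousOn (continuous_comp_torusPoint hf hr).continuousOn
  exact MemLp.of_bound (continuous_comp_torusPoint hf hr).aestronglyMeasurable C
    (ae_of_all _ fun x => hC x (mem_univ x))

lemma HardySpace.exists_integral_rpow_le (hp : p ≠ 0) (hpt : p ≠ ∞) (f : HardySpace p n m) :
    ∃ B, ∀ r ∈ Ico (0 : ℝ) 1, ∫ x, ‖f (torusPoint r x)‖ ^ p.toReal ∂torusMeasure n ≤ B := by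
  obtain ⟨hf, -, hfin⟩ := f.2
  have hp0 : 0 < p.toReal := ENNReal.toReal_pos hp hpt
  refine ⟨(hardyENorm p f).toReal ^ p.toReal, fun r hr => ?_⟩
  have h1 : eLpNorm (fun x : UnitAddTorus (Fin n) => f (torusPoint r x)) p (torusMeasure n) ≤ hardyENorm p f := by
    unfold hardyENorm
    rw [if_neg hpt]
    exact le_iSup₂ (f := fun r (_ : r ∈ Ico (0 : ℝ) 1) =>
      eLpNorm (fun x : UnitAddTorus (Fin n) => f (torusPoint r x)) p (torusMeasure n)) r hr
  rw [eLpNorm_torus_eq hp hpt hf hr, ENNReal.ofReal_le_iff_le_toReal hfin.ne] at h1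
  have h0 : 0 ≤ ∫ x, ‖f (torusPoint r x)‖ ^ p.toReal ∂torusMeasure n := integral_nonneg fun x => by positivity
  have h2 := Real.rpow_le_rpow (by positivity) h1 hp0.le
  rwa [← Real.rpow_mul h0, inv_mul_cancel₀ hp0.ne', Real.rpow_one] at h2

/-- A polynomial uniformly close to a dilate is close to `f` in the Hardy norm, because the dilate
is. -/
lemma HardySpace.exists_vecPoly_near (hp : p ≠ 0) (hpt : p ≠ ∞) (f : HardySpace p n m) {ε : ℝ} (hε : 0 < ε) :
    ∀ᶠ r : ℝ in 𝓝[<] 1, ∃ δ : ℝ, 0 < δ ∧ ∀ P : VecPoly n m,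
      (∀ z ∈ polydisc n, ‖P.eval z - f ((r : ℂ) • z)‖ ≤ δ) →
        hardyENorm p ⇑(P.toHardy p - f) ≤ ENNReal.ofReal ε := by
  have hp0 : 0 < p.toReal := ENNReal.toReal_pos hp hpt
  obtain ⟨hf, -, -⟩ := id f.2
  obtain ⟨B, hB⟩ := f.exists_integral_rpow_le hp hpt
  set q := p.toReal
  -- Chosen so that the quasi-triangle inequality gives `2 ^ q * (η + η) = ε ^ q`.
  set η : ℝ := ε ^ q / (2 * 2 ^ q) with hη
  have hηpos : 0 < η := by positivity
  filter_upwards [eventually_integral_dilate_sub_le hf hp0 hB hηpos, Ioo_mem_nhdsLT zero_lt_one] with r hr hr01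
  refine ⟨η ^ q⁻¹, by positivity, fun P hP => ?_⟩
  unfold hardyENorm
  rw [if_neg hpt]
  refine iSup₂_le fun ρ hρ => ?_
  have hdr : DifferentiableOn ℂ (fun z => f ((r : ℂ) • z)) (polydisc n) := by
    refine hf.comp (by fun_prop) fun z hz i => ?_
    rw [Pi.smul_apply, smul_eq_mul, norm_mul, Complex.norm_real, Real.norm_of_nonneg hr01.1.le]
    have := hz i
    nlinarith [norm_nonneg (z i), hr01.2]
  have hd : DifferentiableOn ℂ ⇑(P.toHardy p - f) (polydisc n) := (P.toHardy p - f).2.1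
  rw [eLpNorm_torus_eq hp hpt hd hρ]
  refine ENNReal.ofReal_le_ofReal ?_
  have hpt' : ∀ x, ‖(P.toHardy p - f) (torusPoint ρ x)‖ ^ q ≤
      2 ^ q * (η + ‖f ((r : ℂ) • torusPoint ρ x) - f (torusPoint ρ x)‖ ^ q) := by
    intro x
    have hx := torusPoint_mem hρ x
    have e1 : (P.toHardy p - f) (torusPoint ρ x) =
        (P.eval (torusPoint ρ x) - f ((r : ℂ) • torusPoint ρ x)) -
        (f (torusPoint ρ x) - f ((r : ℂ) • torusPoint ρ x)) := by
      rw [sub_sub_sub_cancel_right, ← P.toHardy_apply p hx]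
      rfl
    rw [e1]
    refine (norm_sub_rpow_le hp0 _ _).trans ?_
    rw [norm_sub_rev (f (torusPoint ρ x))]
    gcongr
    have := Real.rpow_le_rpow (norm_nonneg _) (hP _ hx) hp0.le
    rwa [← Real.rpow_mul hηpos.le, inv_mul_cancel₀ hp0.ne', Real.rpow_one] at this
  have hcp : ∀ {h : UnitAddTorus (Fin n) → EuclideanSpace ℂ (Fin m)}, Continuous h →
      Continuous fun x => ‖h x‖ ^ q := fun hh => hh.norm.rpow_const fun _ => Or.inr hp0.le
  have c1 := hcp (continuous_comp_torusPoint hd hρ)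
  have c2 : Continuous fun x : UnitAddTorus (Fin n) =>
      ‖f ((r : ℂ) • torusPoint ρ x) - f (torusPoint ρ x)‖ ^ q := hcp ((continuous_comp_torusPoint hdr hρ).sub (continuous_comp_torusPoint hf hρ))
  have hI := integral_mono (integrable_of_continuous_torus c1)
    (integrable_of_continuous_torus (n := n) (v := fun x =>
      2 ^ q * (η + ‖f ((r : ℂ) • torusPoint ρ x) - f (torusPoint ρ x)‖ ^ q)) (by fun_prop)) hpt'
  rw [integral_const_mul, integral_add (integrable_const _) (integrable_of_continuous_torus c2)] at hI
  have hη2 : 2 ^ q * (η + η) = ε ^ q := by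
    rw [hη]
    field_simp
    ring
  have hle : ∫ x, ‖(P.toHardy p - f) (torusPoint ρ x)‖ ^ q ∂torusMeasure n ≤ ε ^ q := by
    refine hI.trans (le_of_le_of_eq ?_ hη2)
    have := hr ρ hρ
    gcongr
    simp
  have := Real.rpow_le_rpow (integral_nonneg fun x => by positivity) hle (inv_nonneg.2 hp0.le)
  rwa [← Real.rpow_mul hε.le, mul_inv_cancel₀ hp0.ne', Real.rpow_one] at this

end Finite

/-! ### Weak-star density of polynomials for `p = ∞`. -/

section Infinite

variable {n m : ℕ}

lemma HardySpace.exists_norm_le (f : HardySpace ∞ n m) : ∃ C, 0 ≤ C ∧ ∀ z ∈ polydisc n, ‖f z‖ ≤ C := by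
  obtain ⟨-, -, hfin⟩ := f.2
  refine ⟨(hardyENorm ∞ f).toReal, ENNReal.toReal_nonneg, fun z hz => ?_⟩
  have h1 : ‖f z‖ₑ ≤ hardyENorm ∞ f := by
    unfold hardyENorm
    rw [if_pos rfl]
    exact le_iSup₂ (f := fun z (_ : z ∈ polydisc n) => ‖f z‖ₑ) z hz
  rw [← ofReal_norm, ENNReal.ofReal_le_iff_le_toReal hfin.ne] at h1
  exact h1

lemma norm_sum_mul_le (y g : EuclideanSpace ℂ (Fin m)) : ‖∑ k, y k * g k‖ ≤ m * (‖y‖ * ‖g‖) := by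
  refine (norm_sum_le_of_le (f := fun k => y k * g k) (n := fun _ => ‖y‖ * ‖g‖) _ fun k _ => ?_).trans (by simp)
  rw [norm_mul]
  gcongr
  · exact PiLp.norm_apply_le y k
  · exact PiLp.norm_apply_le g k

lemma integrable_pairing {h g : UnitAddTorus (Fin n) → EuclideanSpace ℂ (Fin m)} (hh : Continuous h)
    (hg : Integrable g (torusMeasure n)) : Integrable (fun x => ∑ k, h x k * g x k) (torusMeasure n) := by
  obtain ⟨C, hC⟩ := isCompact_univ.exists_bound_of_continuousOn hh.continuousOn
  refine integrable_finsetSum _ fun k _ => ?_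
  refine Integrable.bdd_mul (c := C) ?_ ?_ (ae_of_all _ fun x => (PiLp.norm_apply_le _ k).trans (hC x (mem_univ x)))
  · exact (EuclideanSpace.proj (𝕜 := ℂ) k).integrable_comp hg
  · exact ((EuclideanSpace.proj (𝕜 := ℂ) k).continuous.comp hh).aestronglyMeasurable

lemma norm_integral_pairing_sub_le {h h' g : UnitAddTorus (Fin n) → EuclideanSpace ℂ (Fin m)} (hh : Continuous h)
    (hh' : Continuous h') (hg : Integrable g (torusMeasure n)) :
    ‖(∫ x, ∑ k, h x k * g x k ∂torusMeasure n) - ∫ x, ∑ k, h' x k * g x k ∂torusMeasure n‖ ≤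
      m * ∫ x, ‖h x - h' x‖ * ‖g x‖ ∂torusMeasure n := by
  rw [← integral_sub (integrable_pairing hh hg) (integrable_pairing hh' hg), ← integral_const_mul]
  obtain ⟨C, hC⟩ := isCompact_univ.exists_bound_of_continuousOn (hh.sub hh').continuousOn
  refine norm_integral_le_of_norm_le ?_ (ae_of_all _ fun x => ?_)
  · refine Integrable.const_mul ?_ _
    refine Integrable.bdd_mul (c := C) hg.norm (hh.sub hh').norm.aestronglyMeasurable (ae_of_all _ fun x => ?_)
    rw [norm_norm]
    exact hC x (mem_univ x)
  · have : ∑ k, h x k * g x k - ∑ k, h' x k * g x k = ∑ k, (h x - h' x) k * g x k := by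
      rw [← Finset.sum_sub_distrib]
      exact Finset.sum_congr rfl fun k _ => by rw [PiLp.sub_apply, sub_mul]
    rw [this]
    exact norm_sum_mul_le _ _

lemma tendsto_integral_max_sub_atTop {α : Type*} [MeasurableSpace α] {μ : Measure α} {v : α → ℝ}
    (hv : Integrable v μ) : Tendsto (fun M : ℕ => ∫ x, max (v x - M) 0 ∂μ) atTop (𝓝 0) := by
  have := tendsto_integral_of_dominated_convergence (μ := μ) (F := fun (M : ℕ) x => max (v x - M) 0) (f := fun _ => 0)
    (fun x => ‖v x‖) (fun M => ((hv.aestronglyMeasurable.sub aestronglyMeasurable_const).sup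
      aestronglyMeasurable_const)) hv.norm (fun M => ae_of_all _ fun x => ?_) (ae_of_all _ fun x => ?_)
  · simpa using this
  · rw [Real.norm_of_nonneg (le_max_right _ _), Real.norm_eq_abs]
    refine max_le ?_ (abs_nonneg _)
    have := le_abs_self (v x)
    have : (0 : ℝ) ≤ M := Nat.cast_nonneg M
    linarith
  · obtain ⟨N, hN⟩ := exists_nat_ge (v x)
    refine tendsto_const_nhds.congr' (eventually_atTop.2 ⟨N, fun M hM => ?_⟩)
    have : (N : ℝ) ≤ M := by exact_mod_cast hM
    change (0 : ℝ) = max (v x - (M : ℝ)) 0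
    rw [max_eq_right (by linarith)]

/-- The limit that defines the pairing of `H^∞` with `L¹` exists. -/
lemma HardySpace.tendsto_hardyPairing (f : HardySpace ∞ n m) {g : UnitAddTorus (Fin n) → EuclideanSpace ℂ (Fin m)}
    (hg : Integrable g (torusMeasure n)) :
    Tendsto (fun r => ∫ x : UnitAddTorus (Fin n), ∑ k, f (torusPoint r x) k * g x k ∂torusMeasure n) (𝓝[<] (1 : ℝ))
      (𝓝 (hardyPairing f g)) := by
  obtain ⟨C, hC0, hC⟩ := f.exists_norm_le
  have hf := f.2.1
  have hB : ∀ r ∈ Ico (0 : ℝ) 1, ∫ x, ‖f (torusPoint r x)‖ ^ (1 : ℝ) ∂torusMeasure n ≤ C := by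
    intro r hr
    simp only [Real.rpow_one]
    have := integral_mono (integrable_of_continuous_torus (continuous_comp_torusPoint hf hr).norm)
      (integrable_const C) fun x => hC _ (torusPoint_mem hr x)
    simpa using this
  -- A bounded function has bounded first means, so its dilates are Cauchy in `L¹`.
  have hT := tendsto_integral_norm_sub_rpow hf one_pos hB
  simp only [Real.rpow_one] at hT
  have hev : ∀ᶠ r : ℝ in 𝓝[<] 1, r ∈ Ico (0 : ℝ) 1 :=
    mem_of_superset (Ioo_mem_nhdsLT zero_lt_one) Ioo_subset_Ico_self
  have hcauchy : Cauchy (map (fun r : ℝ => ∫ x : UnitAddTorus (Fin n), ∑ k, f (torusPoint r x) k * g x k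
      ∂torusMeasure n) (𝓝[<] 1)) := by
    rw [cauchy_map_iff]
    refine ⟨inferInstance, ?_⟩
    rw [tendsto_uniformity_iff_dist_tendsto_zero, Metric.tendsto_nhds]
    intro ε hε
    obtain ⟨M, hM⟩ := ((((tendsto_integral_max_sub_atTop hg.norm).const_mul (m * (2 * C))).eventually_lt_const
      (show _ < ε / 2 by rw [mul_zero]; positivity))).exists
    have hT2 := (hT.const_mul (m * (M : ℝ))).eventually_lt_const (show _ < ε / 2 by rw [mul_zero]; positivity)
    filter_upwards [hT2, hev.prod_mk hev] with ⟨s, s'⟩ h1 ⟨hs, hs'⟩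
    dsimp only at *
    have cs := continuous_comp_torusPoint hf hs
    have cs' := continuous_comp_torusPoint hf hs'
    have csub : Continuous fun x : UnitAddTorus (Fin n) => ‖f (torusPoint s x) - f (torusPoint s' x)‖ :=
      (cs.sub cs').norm
    rw [dist_zero_right, Real.norm_of_nonneg dist_nonneg, dist_eq_norm]
    refine (norm_integral_pairing_sub_le cs cs' hg).trans_lt ?_
    have hmax : Integrable (fun x => max (‖g x‖ - M) 0) (torusMeasure n) :=
      (hg.norm.sub (integrable_const _)).sup (integrable_const _)
    -- Split `‖g‖` at height `M`: below it the `L¹`-distance of the dilates counts, above it the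
    -- bound `2 C` and the small tail of `g`.
    have h2 : ∫ x, ‖f (torusPoint s x) - f (torusPoint s' x)‖ * ‖g x‖ ∂torusMeasure n ≤
        ∫ x, (M * ‖f (torusPoint s x) - f (torusPoint s' x)‖ + 2 * C * max (‖g x‖ - M) 0) ∂torusMeasure n := by
      refine integral_mono_of_nonneg (ae_of_all _ fun x => by positivity)
        (((integrable_of_continuous_torus csub).const_mul _).add (hmax.const_mul _))
        (ae_of_all _ fun x => ?_)
      dsimp only
      have h3 : ‖f (torusPoint s x) - f (torusPoint s' x)‖ ≤ 2 * C := by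
        have := norm_sub_le (f (torusPoint s x)) (f (torusPoint s' x))
        have := hC _ (torusPoint_mem hs x)
        have := hC _ (torusPoint_mem hs' x)
        linarith
      have h4 := norm_nonneg (f (torusPoint s x) - f (torusPoint s' x))
      have h5 := le_max_left (‖g x‖ - M) 0
      have h6 := le_max_right (‖g x‖ - M) 0
      nlinarith [mul_le_mul_of_nonneg_right h3 h6, mul_le_mul_of_nonneg_left h5 h4]
    rw [integral_add ((integrable_of_continuous_torus csub).const_mul _) (hmax.const_mul _),
      integral_const_mul, integral_const_mul] at h2
    have h7 := mul_le_mul_of_nonneg_left h2 (Nat.cast_nonneg m : (0 : ℝ) ≤ m)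
    refine h7.trans_lt ?_
    linarith
  obtain ⟨L, hL⟩ := cauchy_map_iff_exists_tendsto.1 hcauchy
  rwa [show hardyPairing f g = L from hL.limUnder_eq]

lemma tendsto_hardyWeakStarTopology {p : ℝ≥0∞} {ι : Type*} {l : Filter ι} {F : ι → HardySpace p n m}
    {f : HardySpace p n m}
    (h : ∀ g, Integrable g (torusMeasure n) → Tendsto (fun j => hardyPairing (F j) g) l (𝓝 (hardyPairing f g))) :
    Tendsto F l (@nhds _ (hardyWeakStarTopology p n m) f) := by
  rw [nhds_iInf, tendsto_iInf]
  rintro ⟨g, hg⟩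
  rw [nhds_induced, tendsto_comap_iff]
  exact h g hg

/-- At radius `ρ` the polynomial is within `1 / (j + 1)` of `f` at radius `r j * ρ`, and the
integrals of `f` near radius `1` are close to their limit. The estimate survives `ρ → 1`. -/
lemma HardySpace.tendsto_hardyPairing_of_near (f : HardySpace ∞ n m) {r : ℕ → ℝ} (hr : Tendsto r atTop (𝓝[<] 1))
    {P : ℕ → VecPoly n m}
    (hP : ∀ᶠ j : ℕ in atTop, ∀ z ∈ polydisc n, ‖(P j).eval z - f ((r j : ℂ) • z)‖ ≤ 1 / ((j : ℝ) + 1))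
    {g : UnitAddTorus (Fin n) → EuclideanSpace ℂ (Fin m)} (hg : Integrable g (torusMeasure n)) :
    Tendsto (fun j => hardyPairing ((P j).toHardy ∞) g) atTop (𝓝 (hardyPairing f g)) := by
  have hf := f.2.1
  rw [Metric.tendsto_nhds]
  intro ε hε
  have hI := Metric.tendsto_nhds.1 (f.tendsto_hardyPairing hg) (ε / 4) (by positivity)
  obtain ⟨s₀, hs₀1, hs₀⟩ := (nhdsLT_basis (1 : ℝ)).eventually_iff.1 hI
  have hsmall : ∀ᶠ j : ℕ in atTop, m * ∫ x, 1 / ((j : ℝ) + 1) * ‖g x‖ ∂torusMeasure n < ε / 4 := by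
    simp only [integral_const_mul]
    refine Tendsto.eventually_lt_const (show 0 < ε / 4 by positivity) ?_
    have := ((tendsto_one_div_add_atTop_nhds_zero_nat (𝕜 := ℝ)).mul_const
      (∫ x, ‖g x‖ ∂torusMeasure n)).const_mul (m : ℝ)
    simpa using this
  filter_upwards [hP, hsmall, hr.eventually (Ioo_mem_nhdsLT (max_lt hs₀1 zero_lt_one))] with j hPj hsj hrj
  have hrs : s₀ < r j := (le_max_left _ _).trans_lt hrj.1
  have hr0 : 0 < r j := (le_max_right _ _).trans_lt hrj.1
  have hlim := (((P j).toHardy ∞).tendsto_hardyPairing hg).dist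
    (tendsto_const_nhds (x := hardyPairing f g) (f := 𝓝[<] (1 : ℝ)))
  refine lt_of_le_of_lt (le_of_tendsto hlim ?_) (show ε / 2 < ε by linarith)
  have hdiv : max (s₀ / r j) 0 < 1 := max_lt ((div_lt_one hr0).2 hrs) zero_lt_one
  filter_upwards [Ioo_mem_nhdsLT hdiv] with ρ hρ
  have hρ0 : 0 < ρ := (le_max_right _ _).trans_lt hρ.1
  have hρ1 : ρ ∈ Ico (0 : ℝ) 1 := ⟨hρ0.le, hρ.2⟩
  have hrρ : s₀ < r j * ρ := by
    have := (le_max_left _ _).trans_lt hρ.1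
    rwa [div_lt_iff₀' hr0] at this
  have hrρ1 : r j * ρ < 1 := mul_lt_one_of_nonneg_of_lt_one_left hr0.le hrj.2 hρ.2.le
  have hrρm : r j * ρ ∈ Ico (0 : ℝ) 1 := ⟨by positivity, hrρ1⟩
  have h1 := hs₀ (show r j * ρ ∈ Ioo s₀ 1 from ⟨hrρ, hrρ1⟩)
  refine (dist_triangle _ (∫ x, ∑ k, f (torusPoint (r j * ρ) x) k * g x k ∂torusMeasure n) _).trans ?_
  have h2 : dist (∫ x, ∑ k, ((P j).toHardy ∞) (torusPoint ρ x) k * g x k ∂torusMeasure n)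
      (∫ x, ∑ k, f (torusPoint (r j * ρ) x) k * g x k ∂torusMeasure n) ≤ ε / 4 := by
    rw [dist_eq_norm]
    refine (norm_integral_pairing_sub_le (continuous_comp_torusPoint ((P j).toHardy ∞).2.1 hρ1)
      (continuous_comp_torusPoint hf hrρm) hg).trans (le_trans ?_ hsj.le)
    refine mul_le_mul_of_nonneg_left ?_ (Nat.cast_nonneg m)
    refine integral_mono_of_nonneg (ae_of_all _ fun x => by positivity) (hg.norm.const_mul _)
      (ae_of_all _ fun x => ?_)
    dsimp only
    gcongr
    have hx := torusPoint_mem hρ1 x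
    have h3 := hPj _ hx
    rw [← (P j).toHardy_apply ∞ hx] at h3
    have h4 : torusPoint (r j * ρ) x = (r j : ℂ) • torusPoint ρ x := by
      ext i
      simp [torusPoint, mul_assoc]
    rw [h4]
    exact h3
  linarith

end Infinite

/-! ### Sequential density and the conclusion. -/

/-- Polynomials are sequentially dense in the Hardy space, with convergence at every point of the polydisc. -/
lemma HardySpace.exists_seq_vecPoly {p : ℝ≥0∞} (hp : p ≠ 0) {n m : ℕ} (f : HardySpace p n m) :
    ∃ P : ℕ → VecPoly n m, Tendsto (fun j => (P j).toHardy p) atTop (𝓝 f) ∧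
      ∀ w ∈ polydisc n, Tendsto (fun j => (P j).eval w) atTop (𝓝 (f w)) := by
  have hf := f.2.1
  have hpoint : ∀ {r : ℕ → ℝ} {P : ℕ → VecPoly n m}, Tendsto r atTop (𝓝[<] 1) →
      (∀ᶠ j : ℕ in atTop, ∀ z ∈ polydisc n, ‖(P j).eval z - f ((r j : ℂ) • z)‖ ≤ 1 / ((j : ℝ) + 1)) →
      ∀ w ∈ polydisc n, Tendsto (fun j => (P j).eval w) atTop (𝓝 (f w)) := by
    intro r P hr hP w hw
    have hopen : IsOpen (polydisc n) := by
      have : polydisc n = ⋂ i, {z | ‖z i‖ < 1} := by ext z; simp [polydisc]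
      rw [this]
      exact isOpen_iInter_of_finite fun i => isOpen_lt (by fun_prop) continuous_const
    have h1 : Tendsto (fun j => f ((r j : ℂ) • w)) atTop (𝓝 (f w)) := by
      have hc : ContinuousAt f w := (hf.continuousOn).continuousAt (hopen.mem_nhds hw)
      refine hc.tendsto.comp ?_
      have h2 : Tendsto (fun j => (r j : ℂ) • w) atTop (𝓝 (((1 : ℝ) : ℂ) • w)) :=
        ((Complex.continuous_ofReal.tendsto 1).comp (hr.mono_right nhdsWithin_le_nhds)).smul_const w
      simpa using h2
    have h3 : Tendsto (fun j => (P j).eval w - f ((r j : ℂ) • w)) atTop (𝓝 0) :=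
      squeeze_zero_norm' (hP.mono fun j hj => hj w hw) tendsto_one_div_add_atTop_nhds_zero_nat
    simpa using h3.add h1
  by_cases hpt : p = ∞
  · subst hpt
    obtain ⟨r, -, hr01, hr⟩ := exists_seq_strictMono_tendsto' (show (0 : ℝ) < 1 from one_pos)
    have hr' : Tendsto r atTop (𝓝[<] 1) :=
      tendsto_nhdsWithin_iff.2 ⟨hr, .of_forall fun j => (hr01 j).2⟩
    choose P hP using fun j : ℕ => exists_vecPoly_near_dilate hf (hr01 j).1 (hr01 j).2
      (show (0 : ℝ) < 1 / ((j : ℝ) + 1) by positivity)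
    refine ⟨P, ?_, hpoint hr' (.of_forall hP)⟩
    have htop : (inferInstance : TopologicalSpace (HardySpace ∞ n m)) = hardyWeakStarTopology ∞ n m := if_pos rfl
    change Tendsto _ _ (@nhds _ (inferInstance : TopologicalSpace (HardySpace ∞ n m)) f)
    rw [htop]
    exact tendsto_hardyWeakStarTopology fun g hg => f.tendsto_hardyPairing_of_near hr' (.of_forall hP) hg
  -- A single polynomial serves both purposes: the Hardy norm, and uniform closeness to a dilate
  -- with `r → 1`, which gives pointwise convergence.
  · have hchoice : ∀ j : ℕ, ∃ r : ℝ, r ∈ Ioo (1 - 1 / ((j : ℝ) + 1)) 1 ∧ ∃ P : VecPoly n m,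
        (∀ z ∈ polydisc n, ‖P.eval z - f ((r : ℂ) • z)‖ ≤ 1 / ((j : ℝ) + 1)) ∧
        hardyENorm p ⇑(P.toHardy p - f) ≤ ENNReal.ofReal (1 / ((j : ℝ) + 1)) := by
      intro j
      have hj : (0 : ℝ) < 1 / ((j : ℝ) + 1) := by positivity
      obtain ⟨r, ⟨⟨δ, hδ, hnear⟩, hr0⟩, hr⟩ := ((f.exists_vecPoly_near hp hpt hj).and
        (Ioo_mem_nhdsLT (zero_lt_one (α := ℝ))) |>.and
        (Ioo_mem_nhdsLT (show 1 - 1 / ((j : ℝ) + 1) < 1 by linarith))).exists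
      obtain ⟨P, hP⟩ := exists_vecPoly_near_dilate hf hr0.1 hr0.2 (lt_min hδ hj)
      exact ⟨r, hr, P, fun z hz => (hP z hz).trans (min_le_right _ _),
        hnear P fun z hz => (hP z hz).trans (min_le_left _ _)⟩
    choose r hr P hP hPn using hchoice
    have hr' : Tendsto r atTop (𝓝[<] 1) := by
      refine tendsto_nhdsWithin_iff.2 ⟨?_, .of_forall fun j => (hr j).2⟩
      refine tendsto_of_tendsto_of_tendsto_of_le_of_le ?_ tendsto_const_nhds (fun j => (hr j).1.le)
        fun j => (hr j).2.le
      simpa using (tendsto_const_nhds (x := (1 : ℝ))).sub (tendsto_one_div_add_atTop_nhds_zero_nat (𝕜 := ℝ))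
    refine ⟨P, ?_, hpoint hr' (.of_forall hP)⟩
    have htop : (inferInstance : TopologicalSpace (HardySpace p n m)) = hardyNormTopology p n m := if_neg hpt
    change Tendsto _ _ (@nhds _ (inferInstance : TopologicalSpace (HardySpace p n m)) f)
    rw [htop]
    refine tendsto_hardyNormTopology fun ε hε => ?_
    have hlim : Tendsto (fun j : ℕ => ENNReal.ofReal (1 / ((j : ℝ) + 1))) atTop (𝓝 0) := by
      have := ENNReal.tendsto_ofReal (tendsto_one_div_add_atTop_nhds_zero_nat (𝕜 := ℝ))
      rwa [ENNReal.ofReal_zero] at this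
    exact (hlim.eventually_lt_const hε).mono fun j hj => (hPn j).trans_lt hj

theorem mainTheorem4 (n m : ℕ) (hn : 1 ≤ n) (hm : 1 ≤ m) (p : ℝ≥0∞) (hp : 0 < p)
    (Λ : HardySpace p n m → ℂ) (hΛ : Continuous Λ) (hne : Λ ≠ 0) (h0 : Λ 0 = 0) :
    ((∀ P Q : VecPoly n m, ∃ z ∈ polydisc n,
        VecPoly.eval ((Λ (P.toHardy p) - Λ (Q.toHardy p)) • (1 : VecPoly n m) - (P - Q)) z = 0) →
      ∃ w ∈ polydisc n, ∃ k : Fin m, ∀ f : HardySpace p n m,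
        Λ f = inner ℂ (EuclideanSpace.single k (1 : ℂ)) (f w)) ∧
    ((∀ P Q : VecPoly n m, ∃ z ∈ polydisc n, ∃ j : Fin m,
        VecPoly.eval ((Λ (P.toHardy p) - Λ (Q.toHardy p)) • (1 : VecPoly n m) - (P - Q)) z j = 0) →
      ∃ w ∈ polydisc n, ∃ k : Fin m, ∀ f : HardySpace p n m,
        Λ f = inner ℂ (EuclideanSpace.single k (1 : ℂ)) (f w)) := by
  have main : (∀ P Q : VecPoly n m, ∃ z ∈ polydisc n, ∃ j : Fin m,
        VecPoly.eval ((Λ (P.toHardy p) - Λ (Q.toHardy p)) • (1 : VecPoly n m) - (P - Q)) z j = 0) →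
      ∃ w ∈ polydisc n, ∃ k : Fin m, ∀ f : HardySpace p n m,
        Λ f = inner ℂ (EuclideanSpace.single k (1 : ℂ)) (f w) := by
    intro h
    have hz : (0 : VecPoly n m).toHardy p = 0 := by
      refine Subtype.ext (funext fun z => ?_)
      have he : (0 : VecPoly n m).eval = 0 := by
        ext z k
        simp [VecPoly.eval]
      change (polydisc n).indicator (0 : VecPoly n m).eval z = 0
      rw [he]
      simp
    obtain ⟨w, hw, k, hk⟩ := VecPoly.exists_eq_eval_of_spectral (F := fun P => Λ (P.toHardy p))
      (by rw [hz, h0]) h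
    refine ⟨w, hw, k, fun f => ?_⟩
    -- Along this sequence `Λ` converges by continuity and the values at `w` converge pointwise;
    -- both agree on polynomials.
    obtain ⟨P, hPf, hPw⟩ := f.exists_seq_vecPoly hp.ne'
    have h1 : Tendsto (fun j => Λ ((P j).toHardy p)) atTop (𝓝 (Λ f)) := (hΛ.tendsto f).comp hPf
    have h2 : Tendsto (fun j => (P j).eval w k) atTop (𝓝 (f w k)) :=
      ((EuclideanSpace.proj (𝕜 := ℂ) k).continuous.tendsto _).comp (hPw w hw)
    simp only [hk] at h1
    rw [tendsto_nhds_unique h1 h2]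
    simp [EuclideanSpace.inner_single_left]
  refine ⟨fun h => main fun P Q => ?_, main⟩
  obtain ⟨z, hz, hzero⟩ := h P Q
  -- A common zero is in particular a zero of the first coordinate, which exists as `m ≥ 1`.
  exact ⟨z, hz, ⟨0, hm⟩, by rw [hzero]; rfl⟩
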